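/- Let $G$ be a (discrete) group and let $\hat G=\varprojlim G/N$ be its profinite completion, where $N$ runs over all normal subgroups of finite index, with the inverse limit topology. A finite $G$-module is a finite abelian group $M$ with the discrete topology and an action of $G$ by group automorphisms; the action map $G\to\operatorname{Aut}(M)$ factors over a unique continuous homomorphism $\hat G\to\operatorname{Aut}(M)$, so $M$ is also a topological $\hat G$-module. The canonical map $G\to\hat G$ induces restriction maps $$H^p(\hat G,M)\longrightarrow H^p(G,M),\qquad p\ge 0,$$ on cohomology defined by continuous cochains. The group $G$ is called good (in Serre's sense) if these maps are bijective for all integers $p\ge 0$ and all finite $G$-modules $M$. A group $P$ is called polycyclic if there is a finite chain of subgroups $1=P_0\subset P_1\subset\dots\subset P_n=P$ such that each $P_{i-1}$ is normal in $P_i$ with cyclic (finite or infinite) quotient $P_i/P_{i-1}$. A group is called almost polycyclic if it contains a polycyclic subgroup of finite index. **Proposition.** Every almost polycyclic group is good. In particular, every finitely generated nilpotent group is good. -/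

import Mathlib

open CategoryTheory

universe u

/-- A group `G` is polycyclic if it has a finite chain of subgroups `⊥ = H 0 ≤ H 1 ≤ ⋯ ≤ H n = ⊤`
in which every `H i` is normal in `H (i + 1)` with (finite or infinite) cyclic quotient. -/
def IsPolycyclic (G : Type u) [Group G] : Prop :=
  ∃ (n : ℕ) (H : ℕ → Subgroup G), H 0 = ⊥ ∧ H n = ⊤ ∧
    ∀ i < n, H i ≤ H (i + 1) ∧
      ∃ _ : ((H i).subgroupOf (H (i + 1))).Normal,
        IsCyclic (H (i + 1) ⧸ (H i).subgroupOf (H (i + 1)))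

/-- A group is almost polycyclic if it contains a polycyclic subgroup of finite index. -/
def IsAlmostPolycyclic (G : Type u) [Group G] : Prop :=
  ∃ H : Subgroup G, H.FiniteIndex ∧ IsPolycyclic H

namespace GoodGroup

variable (G : Type u) [Group G]

/-- The profinite completion of `G`: the inverse limit of the (discrete) quotients of `G` by its
normal subgroups of finite index. -/
abbrev Completion : ProfiniteGrp.{u} := ProfiniteGrp.ProfiniteCompletion.completion (GrpCat.of G)

/-- The canonical homomorphism from the discrete group `G` to its profinite completion. -/
def toCompletion [TopologicalSpace G] [DiscreteTopology G] : G →ₜ* Completion G where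
  toMonoidHom := (ProfiniteGrp.ProfiniteCompletion.eta (GrpCat.of G)).hom
  continuous_toFun := continuous_of_discreteTopology

section Module

variable (M : Type u) [AddCommGroup M] [DistribMulAction G M]

instance finite_units_end [Finite M] : Finite (AddMonoid.End M)ˣ :=
  Finite.of_injective (fun e => ((e : AddMonoid.End M) : M → M))
    (DFunLike.coe_injective.comp Units.val_injective)

/-- The finite group `Aut(M) = End(M)ˣ`, regarded as a (discrete) profinite group. -/
abbrev autGrp [Finite M] : ProfiniteGrp.{u} :=
  ProfiniteGrp.ofFiniteGrp (FiniteGrp.of (AddMonoid.End M)ˣ)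

/-- The homomorphism `G → Aut(M)` given by a `G`-module `M`. -/
def toAut : G →* (AddMonoid.End M)ˣ := (DistribMulAction.toAddMonoidEnd G M).toHomUnits

/-- The extension of the action `G → Aut(M)` on a finite `G`-module `M` to a continuous
homomorphism on the profinite completion of `G`. -/
noncomputable def completionToAut [Finite M] : Completion G →ₜ* autGrp M :=
  (ProfiniteGrp.ProfiniteCompletion.lift (G := GrpCat.of G) (P := autGrp M)
    (GrpCat.ofHom (toAut G M))).hom

theorem completionToAut_toCompletion [Finite M] [TopologicalSpace G] [DiscreteTopology G] (g : G) :
    completionToAut G M (toCompletion G g) = toAut G M g :=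
  ConcreteCategory.congr_hom (ProfiniteGrp.ProfiniteCompletion.lift_eta (G := GrpCat.of G)
    (P := autGrp M) (GrpCat.ofHom (toAut G M))) g

variable [TopologicalSpace M] [DiscreteTopology M]

/-- An automorphism of a discrete abelian group, as a continuous `ℤ`-linear endomorphism. -/
def autToEnd : (AddMonoid.End M)ˣ →* (M →L[ℤ] M) where
  toFun e := ⟨AddMonoidHom.toIntLinearMap (e : AddMonoid.End M), continuous_of_discreteTopology⟩
  map_one' := rfl
  map_mul' _ _ := rfl

/-- A discrete `G`-module `M` as a topological representation of `G` over `ℤ`. -/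
def moduleRep : TopRep ℤ G :=
  .of (X := M) (.ofMonoidHom ((autToEnd M).comp (toAut G M)))

/-- A finite discrete `G`-module `M` as a topological representation of the profinite completion
of `G` over `ℤ`. -/
noncomputable def completionRep [Finite M] : TopRep ℤ (Completion G) :=
  .of (X := M) (.ofMonoidHom
    ((autToEnd M).comp (completionToAut G M : Completion G →* autGrp M)))

variable [TopologicalSpace G] [DiscreteTopology G]

/-- The identity of `M`, as a `G`-equivariant map from `M` with the action of `G` restricted from
that of the profinite completion to `M` with its given action of `G`. -/
noncomputable def resCompletionRep [Finite M] :
    TopRep.res (toCompletion G : G →* Completion G) (completionRep G M) ⟶ moduleRep G M :=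
  TopRep.ofHom
    { toContinuousLinearMap := ContinuousLinearMap.id ℤ M
      isIntertwining' := fun g => congrArg (autToEnd M) (completionToAut_toCompletion G M g) }

/-- The map `H^p(Ĝ, M) → H^p(G, M)` on continuous cohomology induced by the canonical homomorphism
from the discrete group `G` to its profinite completion `Ĝ`. -/
noncomputable abbrev restriction [Finite M] (p : ℕ) :
    continuousCohomology p (completionRep G M) ⟶ continuousCohomology p (moduleRep G M) :=
  ContinuousCohomology.map (toCompletion G) (resCompletionRep G M) p

end Module

end GoodGroup

/-- A group `G` (with the discrete topology) is good if the restriction maps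
`H^p(Ĝ, M) → H^p(G, M)` are bijective for all `p ≥ 0` and all finite (discrete) `G`-modules `M`. -/
def IsGoodGroup (G : Type u) [Group G] : Prop :=
  ∀ [TopologicalSpace G] [DiscreteTopology G]
    (M : Type u) [AddCommGroup M] [Finite M] [TopologicalSpace M] [DiscreteTopology M]
    [DistribMulAction G M] (p : ℕ), Function.Bijective (GoodGroup.restriction G M p)

/-! The proof follows Serre's criterion: `G` is good as soon as, for finite `M`, every class of
positive degree on a subgroup of finite index dies on a smaller one. All homogeneous cochains on
`G`, equivariant or not, form an exact complex with an action of `G`, and the cochains fixed by `H'`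
compute the cohomology of `H'`. So the criterion reads: a cocycle with finite orbit has a primitive
with finite orbit (`VirtuallyAcyclic`).

This property passes from a finitely generated `N` to `N ⊔ zpowers t` when `t` normalizes `N`
(`VirtuallyAcyclic.sup_zpowers`). If a nonzero power of `t` lies in `N`, the index is finite and
nothing happens. Otherwise let `d h = f` with `h` of finite `N`-orbit and, after replacing `t` by a
power, `t • f = f`. The cocycle `t • h - h` is the obstruction to invariance of `h`. In one variable
it is constant, and a power of `t` kills it because `M` is finite. In more variables it is `d k`,
and `k = t • l - l` is solvable (`exists_smul_sub_eq`), so `h - d l` is fixed by `t`. Polycyclic and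
finitely generated nilpotent groups are built from `⊥` by such steps.

To deduce goodness, continuous equivariant cochains of the completion are identified with
equivariant cochains of `G` that factor through a finite quotient (`periodic_pullback`,
`exists_pullback_eq`). It remains to make an equivariant `f` with periodic `d f` periodic by
subtracting a coboundary (`exists_sub_d_periodic`). This is done one variable at a time from the
right (`exists_per_succ`): with the last arguments frozen, `f` has a periodic coboundary in the
remaining ones, and virtual acyclicity supplies a periodic primitive of it. -/

/-- Homogeneous cochains of `G` with values in `M`: a cochain in `n` variables is regarded as a
function on lists that is supported on lists of length `n`. -/
structure ListCochain (G M : Type*) where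
  /-- The underlying function on lists. -/
  toFun : List G → M

/-! ### The complex of homogeneous cochains -/

namespace ListCochain

variable {G M : Type*}

instance : FunLike (ListCochain G M) (List G) M where
  coe := toFun
  coe_injective := fun ⟨_⟩ ⟨_⟩ h => congrArg mk h

@[ext] theorem ext {f h : ListCochain G M} (H : ∀ l, f l = h l) : f = h := DFunLike.ext _ _ H

/-- Fixing the first arguments of a cochain. -/
def prefixed (f : ListCochain G M) (x : List G) : ListCochain G M := ⟨fun l => f (x ++ l)⟩

/-- Fixing the last arguments of a cochain. -/
def suffixed (f : ListCochain G M) (x : List G) : ListCochain G M := ⟨fun l => f (l ++ x)⟩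

theorem prefixed_apply (f : ListCochain G M) (x l : List G) : f.prefixed x l = f (x ++ l) := rfl

theorem suffixed_apply (f : ListCochain G M) (x l : List G) : f.suffixed x l = f (l ++ x) := rfl

section Additive

variable [AddCommGroup M]

instance : Zero (ListCochain G M) := ⟨⟨fun _ => 0⟩⟩
instance : Add (ListCochain G M) := ⟨fun f h => ⟨fun l => f l + h l⟩⟩
instance : Neg (ListCochain G M) := ⟨fun f => ⟨fun l => -f l⟩⟩
instance : Sub (ListCochain G M) := ⟨fun f h => ⟨fun l => f l - h l⟩⟩
instance : SMul ℕ (ListCochain G M) := ⟨fun n f => ⟨fun l => n • f l⟩⟩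
instance : SMul ℤ (ListCochain G M) := ⟨fun n f => ⟨fun l => n • f l⟩⟩

instance : AddCommGroup (ListCochain G M) :=
  DFunLike.coe_injective.addCommGroup _ rfl (fun _ _ => rfl) (fun _ => rfl) (fun _ _ => rfl)
    (fun _ _ => rfl) (fun _ _ => rfl)

@[simp] theorem add_apply (f h : ListCochain G M) (l : List G) : (f + h) l = f l + h l := rfl
@[simp] theorem sub_apply (f h : ListCochain G M) (l : List G) : (f - h) l = f l - h l := rfl
@[simp] theorem neg_apply (f : ListCochain G M) (l : List G) : (-f) l = -f l := rfl
@[simp] theorem zero_apply (l : List G) : (0 : ListCochain G M) l = 0 := rfl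

/-- The differential `∑ (-1) ^ i f (…, omit gᵢ, …)`. -/
def dFun : List G → ListCochain G M → M
  | [], _ => 0
  | g :: l, f => f l - dFun l (f.prefixed [g])

theorem dFun_sub (l : List G) (f h : ListCochain G M) :
    dFun l (f - h) = dFun l f - dFun l h := by
  induction l generalizing f h with
  | nil => simp [dFun]
  | cons g l ih =>
    have : (f - h).prefixed [g] = f.prefixed [g] - h.prefixed [g] := rfl
    simp only [dFun, this, ih, sub_apply]
    abel

/-- The differential of the complex of cochains. -/
def d : ListCochain G M →+ ListCochain G M :=
  AddMonoidHom.ofMapSub (fun f => ⟨fun l => dFun l f⟩) fun f h => ext fun l => dFun_sub l f h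

@[simp] theorem d_nil (f : ListCochain G M) : d f [] = 0 := rfl

theorem d_cons (f : ListCochain G M) (g : G) (l : List G) :
    d f (g :: l) = f l - d (f.prefixed [g]) l := rfl

@[simp] theorem d_d (f : ListCochain G M) : d (d f) = 0 := by
  ext l
  induction l generalizing f with
  | nil => rfl
  | cons g l ih =>
    have : (d f).prefixed [g] = f - d (f.prefixed [g]) := rfl
    rw [d_cons, this, map_sub, sub_apply, ih]
    simp

/-- The value of `d f` on lists of length `n + 1` only depends on `f` on lists of length `n`. -/
theorem d_congr {f h : ListCochain G M} (l : List G)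
    (H : ∀ l' : List G, l'.length + 1 = l.length → f l' = h l') : d f l = d h l := by
  induction l generalizing f h with
  | nil => rfl
  | cons g l ih =>
    rw [d_cons, d_cons, H l rfl,
      ih (f := f.prefixed [g]) (h := h.prefixed [g]) fun l' hl' => H _ (by simpa using hl')]

/-- Omitting an entry of `l` keeps `x` as a frozen suffix, omitting one of `x` keeps `l` as a frozen
prefix. This splitting is what allows the last variables to be treated separately. -/
theorem d_append (f : ListCochain G M) (l x : List G) :
    d f (l ++ x) = d (f.suffixed x) l + (-1 : ℤ) ^ l.length • d (f.prefixed l) x := by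
  induction l generalizing f with
  | nil => simp; rfl
  | cons g l ih =>
    have h1 : (f.prefixed [g]).suffixed x = (f.suffixed x).prefixed [g] := rfl
    have h2 : (f.prefixed [g]).prefixed l = f.prefixed (g :: l) := rfl
    rw [List.cons_append, d_cons, d_cons, ih, h1, h2, List.length_cons, pow_succ]
    simp only [mul_neg, mul_one, neg_smul, suffixed_apply]
    abel

/-- `f` is a cochain in exactly `n` variables. -/
def Supp (n : ℕ) (f : ListCochain G M) : Prop := ∀ l, l.length ≠ n → f l = 0

theorem Supp.d {n : ℕ} {f : ListCochain G M} (hf : f.Supp n) : (d f).Supp (n + 1) := by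
  intro l hl
  rw [d_congr (h := 0) l, map_zero, zero_apply]
  intro l' hl'
  exact hf _ (by omega)

theorem Supp.sub {n : ℕ} {f h : ListCochain G M} (hf : f.Supp n) (hh : h.Supp n) :
    (f - h).Supp n := fun l hl => by rw [sub_apply, hf l hl, hh l hl, sub_zero]

theorem Supp.add {n : ℕ} {f h : ListCochain G M} (hf : f.Supp n) (hh : h.Supp n) :
    (f + h).Supp n := fun l hl => by rw [add_apply, hf l hl, hh l hl, add_zero]

theorem Supp.prefixed {n : ℕ} {f : ListCochain G M} (hf : f.Supp (n + 1)) (g : G) :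
    (f.prefixed [g]).Supp n := fun l hl => hf _ (by simpa using hl)

/-- Contracting homotopy. -/
theorem eq_d_prefixed {f : ListCochain G M} (hf : d f = 0) (g : G) : f = d (f.prefixed [g]) := by
  ext l
  have := DFunLike.congr_fun hf (g :: l)
  rw [d_cons] at this
  exact sub_eq_zero.mp this

end Additive

section Action

variable [Group G] [AddCommGroup M] [DistribMulAction G M]

instance : SMul G (ListCochain G M) := ⟨fun g f => ⟨fun l => g • f (l.map (g⁻¹ * ·))⟩⟩

theorem smul_apply (g : G) (f : ListCochain G M) (l : List G) :
    (g • f) l = g • f (l.map (g⁻¹ * ·)) := rfl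

instance : DistribMulAction G (ListCochain G M) where
  one_smul f := by ext l; simp [smul_apply]
  mul_smul g h f := by
    ext l
    simp [smul_apply, mul_smul, Function.comp_def, mul_assoc]
  smul_zero g := by ext l; simp [smul_apply]
  smul_add g f h := by ext l; simp [smul_apply]

theorem d_smul (g : G) (f : ListCochain G M) : d (g • f) = g • d f := by
  ext l
  induction l generalizing f with
  | nil => simp [smul_apply]
  | cons a l ih =>
    have : (g • f).prefixed [a] = g • f.prefixed [g⁻¹ * a] := rfl
    rw [d_cons, this, ih]
    simp only [smul_apply, List.map_cons, d_cons, smul_sub]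

theorem Supp.smul {n : ℕ} {f : ListCochain G M} (hf : f.Supp n) (g : G) : (g • f).Supp n :=
  fun l hl => by rw [smul_apply, hf _ (by simpa using hl), smul_zero]

end Action

end ListCochain

/-! ### Finite index, finite orbits and heights -/

namespace Subgroup

variable {G : Type*} [Group G]

theorem relIndex_eq_ncard_image_mk (S K : Subgroup G) :
    S.relIndex K = ((QuotientGroup.mk : G → G ⧸ S) '' K).ncard := by
  have h1 : S.subgroupOf K = MulAction.stabilizer K ((1 : G) : G ⧸ S) := by
    ext k
    rw [mem_subgroupOf, MulAction.mem_stabilizer_iff]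
    change _ ↔ (((k : G) * 1 : G) : G ⧸ S) = _
    rw [mul_one, eq_comm, QuotientGroup.eq, inv_one, one_mul]
  have h2 : (QuotientGroup.mk : G → G ⧸ S) '' K = MulAction.orbit K ((1 : G) : G ⧸ S) := by
    ext x
    constructor
    · rintro ⟨k, hk, rfl⟩
      exact ⟨⟨k, hk⟩, congrArg QuotientGroup.mk (mul_one k)⟩
    · rintro ⟨k, rfl⟩
      exact ⟨k, k.2, (congrArg QuotientGroup.mk (mul_one (k : G))).symm⟩
  rw [relIndex, h1, MulAction.index_stabilizer, h2]

theorem relIndex_ne_zero_iff_finite_image_mk {S K : Subgroup G} :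
    S.relIndex K ≠ 0 ↔ ((QuotientGroup.mk : G → G ⧸ S) '' K).Finite := by
  rw [relIndex_eq_ncard_image_mk]
  refine ⟨Set.finite_of_ncard_ne_zero, fun h => ?_⟩
  exact ((Set.ncard_pos h).2 ⟨_, 1, K.one_mem, rfl⟩).ne'

theorem mem_sup_zpowers_iff {N : Subgroup G} {t : G} (ht : t ∈ normalizer (N : Set G)) {x : G} :
    x ∈ N ⊔ zpowers t ↔ ∃ n ∈ N, ∃ j : ℤ, n * t ^ j = x := by
  have := coe_mul_of_right_le_normalizer_left N (zpowers t) (by simpa using ht)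
  rw [← SetLike.mem_coe, this, Set.mem_mul]
  constructor
  · rintro ⟨n, hn, _, ⟨j, rfl⟩, rfl⟩
    exact ⟨n, hn, j, rfl⟩
  · rintro ⟨n, hn, j, rfl⟩
    exact ⟨n, hn, _, ⟨j, rfl⟩, rfl⟩

/-- Modulo `S`, every element `n * t ^ i` can be written as `t ^ r * n'` with `n' ∈ N` and `0 ≤ r <
b`, so finitely many translates of the image of `N` suffice. -/
theorem relIndex_sup_zpowers_ne_zero {S N : Subgroup G} {t : G}
    (ht : t ∈ normalizer (N : Set G)) (hS : S.relIndex N ≠ 0) {b : ℕ} (hb : 0 < b)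
    (htb : t ^ b ∈ S) : S.relIndex (N ⊔ zpowers t) ≠ 0 := by
  rw [relIndex_ne_zero_iff_finite_image_mk] at hS ⊢
  refine Set.Finite.subset (s := ⋃ j ∈ Set.Iio b, (fun x : G ⧸ S => t ^ j • x) ''
    ((QuotientGroup.mk : G → G ⧸ S) '' N))
    ((Set.finite_Iio b).biUnion fun j _ => hS.image _) ?_
  rintro _ ⟨x, hx, rfl⟩
  obtain ⟨n, hn, i, rfl⟩ := (mem_sup_zpowers_iff ht).1 hx
  have hb' : (0 : ℤ) < b := by exact_mod_cast hb
  obtain ⟨r, hr⟩ := Int.eq_ofNat_of_zero_le (Int.emod_nonneg i hb'.ne')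
  have hrb : r < b := by have := Int.emod_lt_of_pos i hb'; omega
  have hi : t ^ i = t ^ r * (t ^ b) ^ (i / b) := by
    rw [← zpow_natCast t r, ← hr, ← zpow_natCast t b, ← zpow_mul, ← zpow_add, Int.emod_add_mul_ediv]
  have htr : (t ^ r) ∈ normalizer (N : Set G) := pow_mem ht r
  refine Set.mem_biUnion hrb ⟨_, ⟨(t ^ r)⁻¹ * n * t ^ r, ?_, rfl⟩, ?_⟩
  · exact (mem_normalizer_iff''.1 htr n).1 hn
  · change ((t ^ r * ((t ^ r)⁻¹ * n * t ^ r) : G) : G ⧸ S) = _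
    rw [QuotientGroup.eq, hi]
    convert zpow_mem htb (i / b) using 1
    group

theorem finite_monoidHom_of_fg {N P : Type*} [Group N] [Group.FG N] [Group P] [Finite P] :
    Finite (N →* P) := by
  obtain ⟨S, hS⟩ := (Group.FG.out : (⊤ : Subgroup N).FG)
  refine Finite.of_injective (fun (φ : N →* P) (s : S) => φ s) fun φ ψ h => ?_
  refine MonoidHom.eq_of_eqOn_dense hS fun s hs => ?_
  exact congrFun h ⟨s, hs⟩

/-- If `N` is finitely generated and the `N`-orbit of `x` is finite, a subgroup of finite index
in `N` fixes all translates of `x` under the normalizer of `N`. -/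
theorem exists_le_stabilizer_smul {X : Type*} [MulAction G X] {N : Subgroup G} (hN : N.FG) {x : X}
    (hx : (MulAction.stabilizer G x).relIndex N ≠ 0) :
    ∃ S : Subgroup G, S.relIndex N ≠ 0 ∧
      ∀ t ∈ normalizer (N : Set G), ∀ s ∈ S, s • t • x = t • x := by
  have : Group.FG N := (Group.fg_iff_subgroup_fg N).2 hN
  set m := (MulAction.orbit N x).ncard
  have hst (y : X) : (MulAction.stabilizer G y).relIndex N = (MulAction.orbit N y).ncard := by
    rw [← MulAction.index_stabilizer]; rfl
  have hm : m ≠ 0 := by rwa [hst] at hx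
  have := finite_monoidHom_of_fg (N := N) (P := Equiv.Perm (Fin m))
  -- A finitely generated group has finitely many actions on `m` points, so their common kernel has
  -- finite index. It serves all `t` at once, since the `N`-orbit of `t • x` is the `t`-translate of
  -- that of `x` and also has `m` points.
  let Q : Subgroup N := ⨅ φ : N →* Equiv.Perm (Fin m), φ.ker
  have hQ : Q.FiniteIndex := finiteIndex_iInf fun φ => inferInstance
  refine ⟨Q.map N.subtype, ?_, ?_⟩
  · rw [relIndex, subgroupOf, comap_map_eq_self_of_injective N.subtype_injective]
    exact hQ.index_ne_zero
  · rintro t ht _ ⟨s, hs, rfl⟩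
    have ho : MulAction.orbit N (t • x) = (t • ·) '' MulAction.orbit N x := by
      ext y
      constructor
      · rintro ⟨n, rfl⟩
        refine ⟨_, ⟨⟨t⁻¹ * n * t, (mem_normalizer_iff''.1 ht n).1 n.2⟩, rfl⟩, ?_⟩
        change t • (t⁻¹ * n * t) • x = (n : G) • t • x
        simp only [smul_smul]; congr 1; group
      · rintro ⟨_, ⟨n, rfl⟩, rfl⟩
        refine ⟨⟨t * n * t⁻¹, (mem_normalizer_iff.1 ht n).1 n.2⟩, ?_⟩
        change (t * n * t⁻¹) • t • x = t • (n : G) • x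
        simp only [smul_smul]; congr 1; group
    have hc : Nat.card (MulAction.orbit N (t • x)) = m := by
      rw [Nat.card_coe_set_eq, ho, Set.ncard_image_of_injective _ (MulAction.injective t)]
    have : Finite (MulAction.orbit N (t • x)) := Nat.finite_of_card_ne_zero (hc ▸ hm)
    let e : MulAction.orbit N (t • x) ≃ Fin m := Finite.equivFinOfCardEq hc
    let φ : N →* Equiv.Perm (Fin m) :=
      e.permCongrHom.toMonoidHom.comp (MulAction.toPermHom N _)
    have h1 : φ s = 1 := (mem_iInf.1 hs φ :)
    have h2 : MulAction.toPermHom N (MulAction.orbit N (t • x)) s = 1 :=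
      (MulEquiv.map_eq_one_iff e.permCongrHom).1 h1
    exact congrArg Subtype.val (DFunLike.congr_fun h2 ⟨t • x, MulAction.mem_orbit_self _⟩)

/-- Choose representatives `s` of the right cosets of `L = N ⊔ zpowers t` and write `g = n * t ^ τ *
s g`. The exponent is unique because `t` has infinite order modulo `N`. -/
theorem exists_height {N : Subgroup G} {t : G} (ht : t ∈ normalizer (N : Set G))
    (ht0 : ∀ j : ℤ, t ^ j ∈ N → j = 0) :
    ∃ τ : G → ℤ, (∀ g, τ (t * g) = τ g + 1) ∧ ∀ n ∈ N, ∀ g, τ (n * g) = τ g := by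
  let L := N ⊔ zpowers t
  let s : G → G := fun g => (Quotient.mk (QuotientGroup.rightRel L) g).out
  have hs (g : G) : g * (s g)⁻¹ ∈ L :=
    QuotientGroup.rightRel_apply.1 (Quotient.exact (Quotient.out_eq
      (Quotient.mk (QuotientGroup.rightRel L) g)))
  have hs' (x : G) (hx : x ∈ L) (g : G) : s (x * g) = s g := by
    refine congrArg Quotient.out (Quotient.sound (QuotientGroup.rightRel_apply.2 ?_))
    simpa using inv_mem hx
  choose n hn τ hτ using fun g => (mem_sup_zpowers_iff ht).1 (hs g)
  have key (a : G) (ha : a ∈ N) (i : ℤ) (g : G) : τ (a * t ^ i * g) = τ g + i := by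
    have hx : a * t ^ i ∈ L := (mem_sup_zpowers_iff ht).2 ⟨a, ha, i, rfl⟩
    have h1 := hτ (a * t ^ i * g)
    rw [hs' _ hx, mul_assoc _ g, ← hτ g] at h1
    have hti : t ^ i ∈ normalizer (N : Set G) := zpow_mem ht i
    have h2 : t ^ (τ (a * t ^ i * g) - (τ g + i)) ∈ N := by
      have : t ^ (τ (a * t ^ i * g) - (τ g + i)) =
          (n (a * t ^ i * g))⁻¹ * a * (t ^ i * n g * (t ^ i)⁻¹) := by
        rw [zpow_sub, eq_inv_mul_of_mul_eq h1]
        group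
      rw [this]
      exact mul_mem (mul_mem (inv_mem (hn _)) ha) ((mem_normalizer_iff.1 hti _).1 (hn g))
    have := ht0 _ h2
    omega
  refine ⟨τ, fun g => ?_, fun a ha g => ?_⟩
  · simpa using key 1 N.one_mem 1 g
  · simpa using key a ha 0 g

end Subgroup

/-! ### Virtual acyclicity and cyclic extensions -/

section

open Subgroup Pointwise

namespace ListCochain

variable {G M : Type*} [Group G] [AddCommGroup M] [DistribMulAction G M]

/-- The orbit of `f` under `H` is finite. -/
def FiniteOrbit (H : Subgroup G) (f : ListCochain G M) : Prop :=
  (MulAction.stabilizer G f).relIndex H ≠ 0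

theorem FiniteOrbit.of_fixed {H S : Subgroup G} {f : ListCochain G M} (hS : S.relIndex H ≠ 0)
    (hf : ∀ s ∈ S, s • f = f) : FiniteOrbit H f :=
  fun h => hS (relIndex_eq_zero_of_le_left (fun s hs => hf s hs) h)

theorem FiniteOrbit.sub {H : Subgroup G} {f h : ListCochain G M} (hf : FiniteOrbit H f)
    (hh : FiniteOrbit H h) : FiniteOrbit H (f - h) :=
  .of_fixed (relIndex_inf_ne_zero hf hh) fun s hs => by
    rw [smul_sub, MulAction.mem_stabilizer_iff.1 hs.1, MulAction.mem_stabilizer_iff.1 hs.2]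

theorem FiniteOrbit.d {H : Subgroup G} {f : ListCochain G M} (hf : FiniteOrbit H f) :
    FiniteOrbit H (d f) :=
  .of_fixed hf fun s hs => by rw [← d_smul, MulAction.mem_stabilizer_iff.1 hs]

theorem FiniteOrbit.mono {H K : Subgroup G} (hHK : H ≤ K) {f : ListCochain G M}
    (hf : FiniteOrbit K f) : FiniteOrbit H f :=
  fun h => hf (relIndex_eq_zero_of_le_right hHK h)

theorem FiniteOrbit.trans {H K : Subgroup G} (hHK : H.relIndex K ≠ 0) {f : ListCochain G M}
    (hf : FiniteOrbit H f) : FiniteOrbit K f :=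
  relIndex_ne_zero_trans hf hHK

theorem FiniteOrbit.smul {H : Subgroup G} {t : G} (ht : t ∈ normalizer (H : Set G))
    {f : ListCochain G M} (hf : FiniteOrbit H f) : FiniteOrbit H (t • f) := by
  have h1 : (MulAction.stabilizer G (t • f)) = (MulAut.conj t) • MulAction.stabilizer G f :=
    MulAction.stabilizer_smul_eq_stabilizer_map_conj t f
  have h2 : (MulAut.conj t) • H = H := by
    ext x
    rw [Subgroup.mem_pointwise_smul_iff_inv_smul_mem, ← map_inv, MulAut.smul_def,
      MulAut.conj_apply, inv_inv]
    exact (mem_normalizer_iff''.1 ht x).symm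
  unfold FiniteOrbit
  rw [h1]
  nth_rewrite 1 [← h2]
  rw [relIndex_pointwise_smul]
  exact hf

variable (M) in
/-- Every cocycle in at least two variables with finite `H`-orbit is the coboundary of a cochain
with finite `H`-orbit: the colimit of the cohomology groups `Hⁿ(H', M)`, where `H'` runs over the
subgroups of finite index in `H`, vanishes for all `n > 0`. -/
def VirtuallyAcyclic (H : Subgroup G) : Prop :=
  ∀ (n : ℕ) (f : ListCochain G M), f.Supp (n + 2) → FiniteOrbit H f → d f = 0 →
    ∃ h : ListCochain G M, h.Supp (n + 1) ∧ FiniteOrbit H h ∧ d h = f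

theorem virtuallyAcyclic_bot : VirtuallyAcyclic M (⊥ : Subgroup G) := fun n f hs _ hd =>
  ⟨f.prefixed [1], hs.prefixed 1, by simp [FiniteOrbit], (eq_d_prefixed hd 1).symm⟩

/-- For `H` of finite index in `K`, finite `H`-orbit and finite `K`-orbit mean the same. -/
theorem VirtuallyAcyclic.of_relIndex_ne_zero {H K : Subgroup G} (hH : VirtuallyAcyclic M H)
    (hHK : H ≤ K) (hr : H.relIndex K ≠ 0) : VirtuallyAcyclic M K := fun n f hs ho hd =>
  let ⟨h, h1, h2, h3⟩ := hH n f hs (ho.mono hHK) hd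
  ⟨h, h1, h2.trans hr, h3⟩

/-- Vanishing of the first cohomology of the infinite cyclic group generated by `t` with
coefficients in the coinduced module of cochains. -/
theorem exists_smul_sub_eq {N : Subgroup G} (hN : N.FG) {t : G}
    (ht : t ∈ normalizer (N : Set G)) (ht0 : ∀ j : ℤ, t ^ j ∈ N → j = 0) {n : ℕ}
    {k : ListCochain G M} (hk : k.Supp (n + 1)) (hk' : FiniteOrbit N k) :
    ∃ l : ListCochain G M, l.Supp (n + 1) ∧ FiniteOrbit N l ∧ t • l - l = k := by
  obtain ⟨τ, hτt, hτN⟩ := exists_height ht ht0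
  obtain ⟨S, hS, hSk⟩ := exists_le_stabilizer_smul hN hk'
  -- The group `S` fixes every `t ^ i • k`. The subgroup `A` records this uniformity in `i`, so that
  -- all `c j` below are fixed by the same `S`.
  let A : AddSubgroup (ListCochain G M) :=
    { carrier := {a | a.Supp (n + 1) ∧ ∀ i : ℤ, ∀ s ∈ S, s • t ^ i • a = t ^ i • a}
      zero_mem' := ⟨fun _ _ => rfl, fun i s _ => by simp⟩
      add_mem' := fun {a b} ha hb => ⟨ha.1.add hb.1, fun i s hs => by
        simp only [smul_add, ha.2 i s hs, hb.2 i s hs]⟩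
      neg_mem' := fun {a} ha => ⟨fun l hl => by simp [ha.1 l hl], fun i s hs => by
        simp only [smul_neg, ha.2 i s hs]⟩ }
  have hkA : k ∈ A := ⟨hk, fun i s hs => hSk _ (zpow_mem ht i) s hs⟩
  have htA (j : ℤ) {a : ListCochain G M} (ha : a ∈ A) : t ^ j • a ∈ A :=
    ⟨ha.1.smul _, fun i s hs => by simp only [smul_smul (t ^ i), ← zpow_add]; exact ha.2 _ s hs⟩
  let φ : Equiv.Perm (ListCochain G M) := (MulAction.toPerm t).trans (Equiv.addRight k)
  have hφ (a : ListCochain G M) : φ a = t • a + k := rfl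
  -- The crossed homomorphism on `ℤ` with `c 1 = k`, as the orbit of `0` under the affine map `φ`;
  -- negative `j` come for free because `φ` is a permutation.
  let c : ℤ → ListCochain G M := fun j => (φ ^ j) 0
  have hc (j : ℤ) : c (j + 1) = t • c j + k := by
    change (φ ^ (j + 1)) 0 = φ ((φ ^ j) 0)
    rw [add_comm, zpow_add, zpow_one, Equiv.Perm.mul_apply]
  have hcA (j : ℤ) : c j ∈ A := by
    induction j with
    | zero => exact A.zero_mem
    | succ i ih => rw [hc]; exact A.add_mem (by simpa using htA 1 ih) hkA
    | pred i ih =>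
      have h1 : c (-i - 1) = t ^ (-1 : ℤ) • (c (-i) - k) := by
        have := hc (-i - 1)
        rw [sub_add_cancel] at this
        rw [this, add_sub_cancel_right, smul_smul, zpow_neg_one, inv_mul_cancel, one_smul]
      rw [h1]
      exact htA _ (A.sub_mem ih hkA)
  -- The height of the first argument selects which `c j` is evaluated. Translation by `t` shifts
  -- the height by one, and the recursion for `c` leaves exactly `k`; as the height is
  -- `N`-invariant, `S ⊓ N` fixes `l`.
  let l : ListCochain G M := ⟨fun x => match x with
    | [] => 0
    | g :: r => -c (τ g) (g :: r)⟩
  have hlc (g : G) (r : List G) : l (g :: r) = -c (τ g) (g :: r) := rfl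
  have hln : l [] = 0 := rfl
  refine ⟨l, ?_, .of_fixed (S := S ⊓ N) ?_ ?_, ?_⟩
  · rintro (_ | ⟨g, r⟩) hx
    · rfl
    · rw [hlc, (hcA _).1 _ hx, neg_zero]
  · rwa [inf_relIndex_right]
  · rintro s ⟨hs, hsN⟩
    ext (_ | ⟨g, r⟩)
    · simp [smul_apply, hln]
    · have h1 : s • c (τ g) = c (τ g) := by simpa using (hcA (τ g)).2 0 s hs
      rw [smul_apply, List.map_cons, hlc, hlc, hτN _ (inv_mem hsN), smul_neg, ← List.map_cons
        (f := (s⁻¹ * ·)), ← smul_apply, h1]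
  · ext (_ | ⟨g, r⟩)
    · simp [smul_apply, hln, hk [] (by simp)]
    · have h1 : τ g = τ (t⁻¹ * g) + 1 := by rw [← hτt, mul_inv_cancel_left]
      rw [sub_apply, smul_apply, List.map_cons, hlc, hlc, h1, hc, smul_neg, ← List.map_cons
        (f := (t⁻¹ * ·)), ← smul_apply, add_apply]
      abel

/-- All translates `t ^ i • h` have the same coboundary, hence differ by constant functions of one
variable. Since `M` is finite, two of them agree at `1`, hence everywhere. -/
theorem exists_pow_smul_eq [Finite M] {t : G} {h : ListCochain G M} (hs : h.Supp 1)
    (hd : d (t • h - h) = 0) : ∃ b : ℕ, 0 < b ∧ t ^ b • h = h := by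
  have hpow (i : ℕ) : d (t ^ i • h) = d h := by
    induction i with
    | zero => simp
    | succ i ih =>
      have h1 : d (t • h) = d h := sub_eq_zero.1 (by rw [← map_sub, hd])
      rw [pow_succ', mul_smul, d_smul, ih, ← d_smul, h1]
  obtain ⟨i, j, hij, he⟩ := Finite.exists_ne_map_eq_of_infinite fun i : ℕ => (t ^ i • h) [1]
  wlog hlt : i < j generalizing i j
  · exact this j i hij.symm he.symm (by omega)
  have hz : d (t ^ i • h - t ^ j • h) = 0 := by rw [map_sub, hpow, hpow, sub_self]
  have heq : t ^ i • h = t ^ j • h := by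
    rw [← sub_eq_zero]
    ext l
    by_cases hl : l.length = 1
    · obtain ⟨g, rfl⟩ := List.length_eq_one_iff.1 hl
      have := DFunLike.congr_fun hz [1, g]
      simp only [d_cons, d_nil, prefixed_apply, sub_zero, List.append_nil, zero_apply] at this
      rw [sub_eq_zero.1 this]
      exact sub_eq_zero.2 he
    · exact ((hs.smul _).sub (hs.smul _)) l hl
  refine ⟨j - i, by omega, ?_⟩
  have h2 : t ^ j = t ^ i * t ^ (j - i) := by rw [← pow_add]; congr 1; omega
  rw [h2, mul_smul] at heq
  exact (MulAction.injective _ heq).symm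

theorem VirtuallyAcyclic.sup_zpowers [Finite M] {N : Subgroup G} (hN : VirtuallyAcyclic M N)
    (hfg : N.FG) {t : G} (ht : t ∈ normalizer (N : Set G)) :
    VirtuallyAcyclic M (N ⊔ zpowers t) := by
  by_cases hfin : ∃ j : ℤ, t ^ j ∈ N ∧ j ≠ 0
  · obtain ⟨j, hj, hj0⟩ := hfin
    refine hN.of_relIndex_ne_zero le_sup_left
      (relIndex_sup_zpowers_ne_zero ht (by simp) (Int.natAbs_pos.2 hj0) ?_)
    rcases j.eq_nat_or_neg with ⟨m, rfl | rfl⟩ <;> simpa using hj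
  push Not at hfin
  intro n f hs ho hd
  -- The orbit of `f` is finite, so a positive power of `t` fixes `f`.
  obtain ⟨a, ha, -, hta⟩ := exists_pow_mem_of_relIndex_ne_zero ho
    (show t ∈ N ⊔ zpowers t from le_sup_right (a := N) (mem_zpowers t))
  set t' := t ^ a with ht'
  have htN : t' ∈ normalizer (N : Set G) := pow_mem ht a
  have hf : t' • f = f := hta.1
  have ht0 (j : ℤ) (hj : t' ^ j ∈ N) : j = 0 := by
    have := hfin (a * j) (by rwa [zpow_mul, zpow_natCast])
    simpa [ha.ne'] using this
  -- A finite `N`-orbit together with a power of `t` fixing `h` gives a finite orbit under the whole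
  -- group.
  suffices H : ∃ h : ListCochain G M, h.Supp (n + 1) ∧ FiniteOrbit N h ∧ d h = f ∧
      ∃ b : ℕ, 0 < b ∧ t' ^ b • h = h by
    obtain ⟨h, h1, h2, h3, b, hb, h4⟩ := H
    refine ⟨h, h1, relIndex_sup_zpowers_ne_zero ht h2 (mul_pos ha hb) ?_, h3⟩
    rw [pow_mul]
    exact h4
  obtain ⟨h, h1, h2, h3⟩ := hN n f hs (ho.mono le_sup_left) hd
  have hd' : d (t' • h - h) = 0 := by rw [map_sub, d_smul, h3, hf, sub_self]
  -- In one variable `t' • h - h` is a constant function and acyclicity does not apply, so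
  -- finiteness of `M` is used instead. Otherwise `h` is corrected by `d l`.
  rcases n with _ | n
  · exact ⟨h, h1, h2, h3, exists_pow_smul_eq h1 hd'⟩
  · obtain ⟨k, k1, k2, k3⟩ := hN n _ ((h1.smul t').sub h1) ((h2.smul htN).sub h2) hd'
    obtain ⟨l, l1, l2, l3⟩ := exists_smul_sub_eq hfg htN ht0 k1 k2
    refine ⟨h - d l, h1.sub l1.d, h2.sub l2.d, by rw [map_sub, d_d, sub_zero, h3], 1, one_pos, ?_⟩
    rw [pow_one, smul_sub, ← d_smul]
    rw [← l3, map_sub] at k3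
    have := k3
    rw [sub_eq_sub_iff_add_eq_add] at this ⊢
    rw [← sub_eq_zero] at this ⊢
    rw [← neg_eq_zero, ← this]
    abel

end ListCochain

end

/-! ### Periodic and equivariant cochains -/

section

open Subgroup

namespace ListCochain

section Periodic

variable {G M : Type*} [Group G]

/-- `f` is invariant under right translation of each of its last `k` arguments by `N`. -/
def Per (N : Subgroup G) (k : ℕ) (f : ListCochain G M) : Prop :=
  ∀ (l z : List G) (g n : G), n ∈ N → z.length < k → f (l ++ (g * n) :: z) = f (l ++ g :: z)

variable {N N' : Subgroup G} {k : ℕ} {f h : ListCochain G M}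

theorem Per.anti (hf : Per N k f) (hN : N' ≤ N) : Per N' k f :=
  fun l z g n hn hz => hf l z g n (hN hn) hz

theorem Per.of_le (hf : Per N k f) {k' : ℕ} (hk : k' ≤ k) : Per N k' f :=
  fun l z g n hn hz => hf l z g n hn (hz.trans_le hk)

theorem Per.prefixed (hf : Per N k f) (x : List G) : Per N k (f.prefixed x) :=
  fun l z g n hn hz => by
    rw [prefixed_apply, prefixed_apply, ← List.append_assoc, ← List.append_assoc]
    exact hf _ z g n hn hz

theorem Per.append_eq (hf : Per N k f) {x y : List G}
    (hxy : List.Forall₂ (fun a b => a⁻¹ * b ∈ N) x y) (hx : x.length ≤ k) (l : List G) :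
    f (l ++ x) = f (l ++ y) := by
  induction hxy generalizing l with
  | nil => rfl
  | @cons a b x y hab hxy ih =>
    have h1 := ih (by simp at hx; omega) (l ++ [b])
    have h2 := hf l x a (a⁻¹ * b) hab (by simp at hx; omega)
    rw [mul_inv_cancel_left] at h2
    simp only [List.append_assoc, List.singleton_append] at h1
    rw [← h2, h1]

variable [AddCommGroup M]

theorem Per.sub (hf : Per N k f) (hh : Per N k h) : Per N k (f - h) :=
  fun l z g n hn hz => by rw [sub_apply, sub_apply, hf l z g n hn hz, hh l z g n hn hz]

theorem Per.d (hf : Per N k f) : Per N k (d f) := by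
  intro l z g n hn hz
  induction l generalizing f with
  | nil =>
    simp only [List.nil_append, d_cons]
    congr 1
    exact d_congr _ fun z' hz' => hf [] z' g n hn (by omega)
  | cons a l ih =>
    rw [List.cons_append, List.cons_append, d_cons, d_cons, ih (hf.prefixed [a]), hf l z g n hn hz]

theorem Supp.per_of_le {n : ℕ} (hs : f.Supp n) (hnk : n ≤ k) (hf : Per N k f) (k' : ℕ) :
    Per N k' f := by
  intro l z g n hn hz
  by_cases h : z.length < k
  · exact hf l z g n hn h
  · rw [hs _ (by simp; omega), hs _ (by simp; omega)]

theorem Supp.per_succ {m : ℕ} (hs : f.Supp (m + 1 + k)) (hf : Per N k f)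
    (H : ∀ (l z : List G) (g n : G), n ∈ N → l.length = m → z.length = k →
      f (l ++ (g * n) :: z) = f (l ++ g :: z)) : Per N (k + 1) f := by
  intro l z g n hn hz
  rcases (Nat.lt_succ_iff.1 hz).lt_or_eq with h | h
  · exact hf l z g n hn h
  · by_cases hl : l.length = m
    · exact H l z g n hn hl h
    · rw [hs _ (by simp; omega), hs _ (by simp; omega)]

end Periodic

variable {G M : Type*} [Group G] [AddCommGroup M] [DistribMulAction G M]

/-- An equivariant cochain. -/
def Inv (f : ListCochain G M) : Prop := ∀ g : G, g • f = f

theorem Inv.apply_map {f : ListCochain G M} (hf : f.Inv) (g : G) (l : List G) :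
    f (l.map (g * ·)) = g • f l := by
  conv_lhs => rw [← hf g]
  rw [smul_apply, List.map_map]
  simp [Function.comp_def]

theorem inv_of_apply_map {f : ListCochain G M} (hf : ∀ g l, f (l.map (g * ·)) = g • f l) :
    f.Inv := fun g => by
  ext l
  rw [smul_apply, hf, smul_inv_smul]

theorem Inv.sub {f h : ListCochain G M} (hf : f.Inv) (hh : h.Inv) : (f - h).Inv :=
  fun g => by rw [smul_sub, hf, hh]

theorem Inv.add {f h : ListCochain G M} (hf : f.Inv) (hh : h.Inv) : (f + h).Inv :=
  fun g => by rw [smul_add, hf, hh]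

theorem Inv.d {f : ListCochain G M} (hf : f.Inv) : (d f).Inv :=
  fun g => by rw [← d_smul, hf]

end ListCochain

end

/-! ### Equivariant periodic primitives -/

section

open Subgroup

namespace ListCochain

variable {G M : Type*} [Group G] [AddCommGroup M] [DistribMulAction G M]

theorem forall₂_smul_self {N : Subgroup G} [hN : N.Normal] {n : G} (hn : n ∈ N) (x : List G) :
    List.Forall₂ (fun a b => a⁻¹ * b ∈ N) x (x.map (n * ·)) := by
  rw [List.forall₂_map_right_iff, List.forall₂_same]
  exact fun a _ => by simpa [mul_assoc] using hN.conj_mem n hn a⁻¹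

theorem forall₂_out {N : Subgroup G} (x : List G) :
    List.Forall₂ (fun a b => a⁻¹ * b ∈ N) x
      ((x.map (QuotientGroup.mk : G → G ⧸ N)).map Quotient.out) := by
  rw [List.forall₂_map_right_iff, List.forall₂_map_right_iff, List.forall₂_same]
  exact fun a _ => QuotientGroup.eq.1 (QuotientGroup.out_eq' (a : G ⧸ N)).symm

/-- By periodicity the family takes finitely many values, each fixed by `N`. Choosing one primitive
of finite orbit per value and transporting it by the first entry of `x` keeps equivariance, and
finitely many stabilizers still meet in a subgroup of finite index. -/
theorem exists_primitive_family (hG : VirtuallyAcyclic M (⊤ : Subgroup G)) {N : Subgroup G}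
    [N.Normal] [N.FiniteIndex] {p m : ℕ} {U : List G → ListCochain G M}
    (hs : ∀ x, x.length = m + 1 → (U x).Supp (p + 2)) (hd : ∀ x, x.length = m + 1 → d (U x) = 0)
    (hU : ∀ x, x.length = m + 1 → ∀ g : G, U (x.map (g * ·)) = g • U x)
    (hp : ∀ x y, x.length = m + 1 → List.Forall₂ (fun a b => a⁻¹ * b ∈ N) x y → U x = U y) :
    ∃ (N' : Subgroup G) (W : List G → ListCochain G M), N'.Normal ∧ N'.FiniteIndex ∧ N' ≤ N ∧
      (∀ x, x.length = m + 1 → (W x).Supp (p + 1)) ∧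
      (∀ x, x.length = m + 1 → d (W x) = U x) ∧
      (∀ x, x.length = m + 1 → ∀ g : G, W (x.map (g * ·)) = g • W x) ∧
      (∀ x y, x.length = m + 1 → List.Forall₂ (fun a b => a⁻¹ * b ∈ N') x y → W x = W y) := by
  let R : Set (ListCochain G M) := U '' {x | x.length = m + 1}
  have hR : R.Finite := by
    refine ((List.finite_length_eq (G ⧸ N) (m + 1)).image
      fun ξ => U (ξ.map Quotient.out)).subset ?_
    rintro _ ⟨x, hx, rfl⟩
    exact ⟨x.map QuotientGroup.mk, by simpa using hx, (hp _ _ hx (forall₂_out x)).symm⟩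
  have hfix (n : G) (hn : n ∈ N) (x : List G) (hx : x.length = m + 1) : n • U x = U x := by
    rw [← hU x hx n, ← hp _ _ hx (forall₂_smul_self hn x)]
  have hw (u : ListCochain G M) : ∃ h : ListCochain G M, u ∈ R →
      h.Supp (p + 1) ∧ FiniteOrbit ⊤ h ∧ d h = u := by
    by_cases hu : u ∈ R
    · obtain ⟨x, hx, rfl⟩ := hu
      obtain ⟨h, h'⟩ := hG p (U x) (hs x hx) (.of_fixed (S := N)
        (by rw [relIndex_top_right]; exact FiniteIndex.index_ne_zero)
        fun n hn => hfix n hn x hx) (hd x hx)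
      exact ⟨h, fun _ => h'⟩
    · exact ⟨0, fun h => (hu h).elim⟩
  choose w hw using hw
  have : Finite R := hR
  let S : Subgroup G := N ⊓ ⨅ u : R, MulAction.stabilizer G (w u)
  have hS : S.FiniteIndex := ⟨index_inf_ne_zero FiniteIndex.index_ne_zero <| by
    rw [← relIndex_top_right]
    exact relIndex_iInf_ne_zero fun u => (hw u u.2).2.1⟩
  -- Translate `x` so that its first entry is `1`, take the chosen primitive there, and translate
  -- back.
  let W : List G → ListCochain G M := fun x => match x with
    | [] => 0
    | a :: r => a • w (U ((a :: r).map (a⁻¹ * ·)))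
  have hW (a : G) (r : List G) : W (a :: r) = a • w (U ((a :: r).map (a⁻¹ * ·))) := rfl
  have hmem (a : G) (r : List G) (hr : (a :: r).length = m + 1) :
      U ((a :: r).map (a⁻¹ * ·)) ∈ R := ⟨_, by simpa using hr, rfl⟩
  have hNS : S.normalCore ≤ N := (normalCore_le S).trans inf_le_left
  refine ⟨S.normalCore, W, inferInstance, inferInstance, hNS, ?_, ?_, ?_, ?_⟩
  · rintro (_ | ⟨a, r⟩) hx
    · simp at hx
    · exact (hw _ (hmem a r hx)).1.smul a
  · rintro (_ | ⟨a, r⟩) hx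
    · simp at hx
    · rw [hW, d_smul, (hw _ (hmem a r hx)).2.2, hU _ hx, smul_inv_smul]
  · rintro (_ | ⟨a, r⟩) hx g
    · simp at hx
    · rw [List.map_cons, hW, hW, smul_smul]
      congr 3
      simp [Function.comp_def, mul_assoc]
  · rintro (_ | ⟨a, r⟩) (_ | ⟨b, s⟩) hx hxy
    · simp at hx
    · simp at hx
    · simp at hxy
    · have hab : a⁻¹ * b ∈ S.normalCore := (List.forall₂_cons.1 hxy).1
      have hy : (b :: s).length = m + 1 := hxy.length_eq ▸ hx
      -- Both values are translates of the same `U (a :: r)`, and they differ by the action of `(a⁻¹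
      -- * b)⁻¹ ∈ N`, which is trivial.
      have h1 : U ((b :: s).map (b⁻¹ * ·)) = U ((a :: r).map (a⁻¹ * ·)) := by
        have h2 := hp _ _ hx (hxy.imp fun _ _ h => hNS h)
        have h3 := hfix (a⁻¹ * b)⁻¹ (inv_mem (hNS hab)) ((a :: r).map (a⁻¹ * ·)) (by simpa using hx)
        rw [hU _ hx, hU _ hy, ← h2] at *
        rw [← h3, smul_smul]
        congr 1
        group
      have h4 : (a⁻¹ * b) • w (U ((a :: r).map (a⁻¹ * ·))) = w (U ((a :: r).map (a⁻¹ * ·))) :=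
        MulAction.mem_stabilizer_iff.1
          (mem_iInf.1 (normalCore_le S hab).2 ⟨_, hmem a r hx⟩)
      rw [hW, hW, h1]
      conv_lhs => rw [← h4]
      rw [smul_smul, mul_inv_cancel_left]

end ListCochain

end

/-! ### Making cochains periodic, one variable at a time -/

section

open Subgroup

namespace ListCochain

section

variable {G M : Type*}

theorem exists_eq_append {q k : ℕ} {L : List G} (hL : L.length = q + k) :
    ∃ l x, l.length = q ∧ x.length = k ∧ L = l ++ x :=
  ⟨L.take q, L.drop q, by simp; omega, by simp; omega, (List.take_append_drop q L).symm⟩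

theorem exists_eq_append_cons {q k : ℕ} {L : List G} (hL : L.length = q + 1 + k) :
    ∃ l y x, l.length = q ∧ x.length = k ∧ L = l ++ y :: x := by
  obtain ⟨l, x, hl, hx, rfl⟩ := exists_eq_append (q := q) (k := k + 1) (L := L) (by omega)
  obtain ⟨y, x, rfl⟩ := List.exists_cons_of_length_eq_add_one hx
  exact ⟨l, y, x, hl, by simpa using hx, rfl⟩

variable [AddCommGroup M]

theorem d_append_cons (f : ListCochain G M) (l x : List G) (y : G) :
    d f (l ++ y :: x) = d (f.suffixed (y :: x)) l +
      (-1 : ℤ) ^ l.length • (f (l ++ x) - d (f.prefixed (l ++ [y])) x) := by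
  rw [d_append, d_cons]
  have : (f.prefixed l).prefixed [y] = f.prefixed (l ++ [y]) := by
    ext z; simp [prefixed_apply]
  rw [this, prefixed_apply]

theorem Supp.eq_zero {f : ListCochain G M} (hs : f.Supp 0) (h0 : f [] = 0) : f = 0 := by
  ext l
  by_cases hl : l.length = 0
  · rw [List.length_eq_zero_iff.1 hl, h0]; rfl
  · exact hs l hl

theorem Supp.suffixed {f : ListCochain G M} {p k : ℕ} (hf : f.Supp (p + k)) {x : List G}
    (hx : x.length = k) : (f.suffixed x).Supp p :=
  fun l hl => hf _ (by simp; omega)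

variable [Group G]

theorem d_prefixed_eq {N : Subgroup G} {k : ℕ} {f : ListCochain G M} (hf : Per N k f)
    (l : List G) {y y' : G} {x : List G} (hy : y⁻¹ * y' ∈ N) (hx : x.length ≤ k) :
    d (f.prefixed (l ++ [y])) x = d (f.prefixed (l ++ [y'])) x := by
  refine d_congr x fun z hz => ?_
  have := hf l z y (y⁻¹ * y') hy (by omega)
  rw [mul_inv_cancel_left] at this
  simpa [prefixed_apply] using this.symm

/-- The coboundary of `f` in all but the last `k + 1` variables is periodic in these variables. -/
theorem d_suffixed_eq {N : Subgroup G} {k : ℕ} {f : ListCochain G M}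
    (hf : Per N k f) (hdf : Per N (k + 1) (d f)) {x x' : List G} (hx : x.length = k + 1)
    (hxx' : List.Forall₂ (fun a b => a⁻¹ * b ∈ N) x x') :
    d (f.suffixed x) = d (f.suffixed x') := by
  obtain ⟨y, x, rfl⟩ := List.exists_cons_of_length_eq_add_one hx
  obtain ⟨y', x', hy, hxx, rfl⟩ := List.forall₂_cons_left_iff.1 hxx'
  have hxk : x.length = k := by simpa using hx
  ext l
  have h1 := hdf.append_eq hxx' hx.le l
  -- Every term of `d f (l ++ y :: x)` other than `d (f.suffixed (y :: x)) l` omits `y` or an entry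
  -- of `x`; such terms have at most `k` arguments after `l`, so periodicity of `f` suffices.
  rw [d_append_cons, d_append_cons, hf.append_eq hxx hxk.le l] at h1
  have h2 : d (f.prefixed (l ++ [y])) x = d (f.prefixed (l ++ [y])) x' :=
    (hf.prefixed _).d.append_eq hxx hxk.le []
  rw [h2, d_prefixed_eq hf l hy (by rw [← hxx.length_eq, hxk])] at h1
  exact add_right_cancel h1

/-- A cochain that factors through a finite quotient of `G`. -/
def Periodic (f : ListCochain G M) : Prop :=
  ∃ N : Subgroup G, N.Normal ∧ N.FiniteIndex ∧ ∀ k, Per N k f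

theorem periodic_zero : Periodic (0 : ListCochain G M) :=
  ⟨⊤, inferInstance, inferInstance, fun _ _ _ _ _ _ _ => rfl⟩

end

variable {G M : Type*} [Group G] [AddCommGroup M] [DistribMulAction G M]

theorem Inv.suffixed {f : ListCochain G M} (hf : f.Inv) (g : G) (x : List G) :
    f.suffixed (x.map (g * ·)) = g • f.suffixed x := by
  ext l
  rw [smul_apply, suffixed_apply, suffixed_apply, ← hf.apply_map, List.map_append, List.map_map]
  simp [Function.comp_def]

/-- The cocycles `d (f.suffixed x)` depend on `x` periodically although the `f.suffixed x` need not.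
Their primitives from `exists_primitive_family` are assembled into a single cochain `w`. -/
theorem exists_per_primitive (hG : VirtuallyAcyclic M (⊤ : Subgroup G)) {N : Subgroup G}
    [N.Normal] [N.FiniteIndex] {q k : ℕ} {f : ListCochain G M} (hs : f.Supp (q + 1 + 1 + k))
    (hi : f.Inv) (hf : Per N k f) (hdf : Per N (k + 1) (d f)) :
    ∃ (N' : Subgroup G) (w : ListCochain G M), N'.Normal ∧ N'.FiniteIndex ∧ N' ≤ N ∧
      w.Supp (q + 1 + 1 + k) ∧ w.Inv ∧ Per N' (k + 1) w ∧
      ∀ x, x.length = k + 1 → d (f.suffixed x) = d (w.suffixed x) := by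
  obtain ⟨N', W, h1, h2, h3, hWs, hWd, hWg, hWp⟩ := exists_primitive_family hG (N := N) (p := q)
    (m := k) (U := fun x => d (f.suffixed x))
    (fun x hx => Supp.d (Supp.suffixed (by convert hs using 1; ring) hx))
    (fun x _ => d_d _)
    (fun x _ g => by simp only [hi.suffixed, d_smul])
    (fun x y hx hxy => d_suffixed_eq hf hdf hx hxy)
  let w : ListCochain G M := ⟨fun L => if L.length = q + 1 + 1 + k then
    W (L.drop (q + 1)) (L.take (q + 1)) else 0⟩
  have hws : w.Supp (q + 1 + 1 + k) := fun L hL => if_neg hL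
  have hw (l x : List G) (hx : x.length = k + 1) : w (l ++ x) = W x l := by
    by_cases hl : l.length = q + 1
    · change ite _ _ _ = _
      rw [if_pos (by simp; omega), ← hl, List.drop_left, List.take_left]
    · rw [hws _ (by simp; omega), hWs x hx l hl]
  refine ⟨N', w, h1, h2, h3, hws, ?_, ?_, ?_⟩
  · refine inv_of_apply_map fun g L => ?_
    by_cases hL : L.length = (q + 1) + (k + 1)
    · obtain ⟨l, x, -, hx, rfl⟩ := exists_eq_append hL
      rw [List.map_append, hw _ _ (by simpa using hx), hw _ _ hx, hWg x hx, smul_apply,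
        List.map_map]
      simp [Function.comp_def]
    · rw [hws _ (by simp; omega), hws _ (by omega), smul_zero]
  · intro l z g n hn hz
    by_cases hL : l.length + (z.length + 1) = (q + 1) + (k + 1)
    · obtain ⟨l, l', -, hl', rfl⟩ := exists_eq_append (q := q + 1) (k := k - z.length) (L := l)
        (by omega)
      rw [List.append_assoc, List.append_assoc, hw _ _ (by simp; omega), hw _ _ (by simp; omega)]
      refine (DFunLike.congr_fun (hWp _ _ (by simp; omega) ?_) l).symm
      refine List.rel_append (R := fun a b => a⁻¹ * b ∈ N') (List.forall₂_same.2 fun a _ => by simp)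
        (List.Forall₂.cons (by simpa using hn) (List.forall₂_same.2 fun a _ => by simp))
    · rw [hws _ (by simp; omega), hws _ (by simp; omega)]
  · intro x hx
    have : w.suffixed x = W x := by ext l; exact hw l x hx
    rw [this, hWd x hx]

/-- With `w` from `exists_per_primitive`, the difference `v = f - w` is closed once its last `k + 1`
arguments are frozen. A contracting homotopy in the free variables writes it as a coboundary there,
up to terms already periodic. -/
theorem exists_per_succ (hG : VirtuallyAcyclic M (⊤ : Subgroup G)) {N : Subgroup G}
    [N.Normal] [N.FiniteIndex] {p k : ℕ} {f : ListCochain G M} (hs : f.Supp (p + 1 + k))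
    (hi : f.Inv) (hf : Per N k f) (hdf : Per N (k + 1) (d f)) :
    ∃ (N' : Subgroup G) (h : ListCochain G M), N'.Normal ∧ N'.FiniteIndex ∧ N' ≤ N ∧
      h.Supp (p + k) ∧ h.Inv ∧ h [] = 0 ∧ Per N' k h ∧ Per N' (k + 1) (f - d h) := by
  -- For `p = 0` no variable is free: `d (f.suffixed x)` evaluated at one argument is `f x`, so `f`
  -- is already periodic and `h = 0` works.
  rcases p with _ | q
  · refine ⟨N, 0, inferInstance, inferInstance, le_rfl, fun _ _ => rfl, fun g => smul_zero g, rfl,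
      fun _ _ _ _ _ _ => rfl, ?_⟩
    rw [map_zero, sub_zero]
    refine Supp.per_succ hs hf fun l z g n hn hl hz => ?_
    obtain rfl := List.length_eq_zero_iff.1 hl
    have := d_suffixed_eq hf hdf (x := g :: z) (x' := (g * n) :: z) (by simpa using hz)
      (List.Forall₂.cons (by simpa using hn) (List.forall₂_same.2 fun a _ => by simp))
    simpa [d_cons, suffixed_apply] using (DFunLike.congr_fun this [1]).symm
  obtain ⟨N', w, h1, h2, hN', hws, hwi, hw, hwd⟩ := exists_per_primitive hG hs hi hf hdf
  set v := f - w with hv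
  have hvs : v.Supp (q + 1 + 1 + k) := hs.sub hws
  have hvi : v.Inv := hi.sub hwi
  have hvp : Per N' k v := (hf.anti hN').sub (hw.of_le (by omega))
  have hvd (x : List G) (hx : x.length = k + 1) : d (v.suffixed x) = 0 := by
    have : v.suffixed x = f.suffixed x - w.suffixed x := rfl
    rw [this, map_sub, hwd x hx, sub_self]
  -- The contracting homotopy inserts a base point in front. Taking for it the first frozen
  -- argument, at index `q`, rather than a constant makes `h` equivariant; the default `1` of `getD`
  -- is never reached.
  let h : ListCochain G M := ⟨fun L => if L.length = q + 1 + k then v (L.getD q 1 :: L) else 0⟩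
  have hhs : h.Supp (q + 1 + k) := fun L hL => if_neg hL
  have hh (l x : List G) (y : G) (hl : l.length = q) (hx : x.length = k) :
      h (l ++ y :: x) = v (y :: (l ++ y :: x)) := by
    change ite _ _ _ = _
    rw [if_pos (by simp; omega)]
    simp [← hl]
  have hhi : h.Inv := by
    refine inv_of_apply_map fun g L => ?_
    by_cases hL : L.length = q + 1 + k
    · obtain ⟨l, y, x, hl, hx, rfl⟩ := exists_eq_append_cons hL
      rw [hh _ _ _ hl hx, ← hvi.apply_map, List.map_append, List.map_cons,
        hh _ _ _ (by simpa using hl) (by simpa using hx)]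
      simp
    · rw [hhs _ (by simpa using hL), hhs _ hL, smul_zero]
  have hhp : Per N' k h := by
    intro l z g n hn hz
    by_cases hL : l.length + (z.length + 1) = q + 1 + k
    · obtain ⟨l, y, l', hl, hl', rfl⟩ := exists_eq_append_cons (q := q) (k := k - 1 - z.length)
        (L := l) (by omega)
      simp only [List.append_assoc, List.cons_append]
      rw [hh _ _ _ hl (by simp; omega), hh _ _ _ hl (by simp; omega)]
      simpa using hvp (y :: (l ++ y :: l')) z g n hn hz
    · rw [hhs _ (by simp; omega), hhs _ (by simp; omega)]
  refine ⟨N', h, h1, h2, hN', hhs, hhi, hhs _ (by simp; omega), hhp, ?_⟩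
  have hds : (f - d h).Supp (q + 1 + 1 + k) :=
    hs.sub (by convert hhs.d using 1; ring)
  refine Supp.per_succ hds ((hf.anti hN').sub hhp.d) ?_
  -- The part `v` of `f` cancels against the coboundary of `h` in the free variables. What remains
  -- is `w`, a term without `y`, and a term where `y` is among the last `k` arguments of `h`.
  have key (l z : List G) (y : G) (hl : l.length = q + 1) (hz : z.length = k) :
      (f - d h) (l ++ y :: z) = w (l ++ y :: z) -
        (-1 : ℤ) ^ l.length • (h (l ++ z) - d (h.prefixed (l ++ [y])) z) := by
    have h3 := DFunLike.congr_fun (hvd (y :: z) (by simpa using hz)) (y :: l)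
    rw [d_cons, zero_apply, sub_eq_zero] at h3
    have h4 : d (h.suffixed (y :: z)) l = d ((v.suffixed (y :: z)).prefixed [y]) l :=
      d_congr l fun l' hl' => hh l' z y (by omega) hz
    have h5 : f (l ++ y :: z) = w (l ++ y :: z) + v (l ++ y :: z) := by simp [hv]
    rw [sub_apply, d_append_cons, h4, ← h3, h5, suffixed_apply]
    abel
  intro l z g n hn hl hz
  rw [key l z _ hl hz, key l z _ hl hz, hw l z g n hn (by omega),
    ← d_prefixed_eq hhp l (y := g) (y' := g * n) (by simpa using hn) hz.le]

/-- The complex of equivariant periodic cochains is quasi-isomorphic to the complex of all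
equivariant cochains. -/
theorem exists_sub_d_periodic (hG : VirtuallyAcyclic M (⊤ : Subgroup G)) {n : ℕ}
    {f : ListCochain G M} (hs : f.Supp (n + 1)) (hi : f.Inv) (hdf : Periodic (d f)) :
    ∃ h : ListCochain G M, h.Supp n ∧ h.Inv ∧ h [] = 0 ∧ Periodic (f - d h) := by
  obtain ⟨N₀, hN₀, hN₀', hdf⟩ := hdf
  -- Induction on the number of periodic variables. Subtracting `d h` does not change the
  -- coboundary, so the hypothesis on `d f` persists.
  have key (k : ℕ) (hk : k ≤ n + 1) : ∃ (N : Subgroup G) (h : ListCochain G M), N.Normal ∧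
      N.FiniteIndex ∧ N ≤ N₀ ∧ h.Supp n ∧ h.Inv ∧ h [] = 0 ∧ Per N k (f - d h) := by
    induction k with
    | zero => exact ⟨N₀, 0, hN₀, hN₀', le_rfl, fun _ _ => rfl, fun g => smul_zero g, rfl,
        fun _ _ _ _ _ h => absurd h (Nat.not_lt_zero _)⟩
    | succ k ih =>
      obtain ⟨N, h, h1, h2, h3, h4, h5, h6, h7⟩ := ih (by omega)
      obtain ⟨p, rfl⟩ : ∃ p, n = p + k := ⟨n - k, by omega⟩
      obtain ⟨N', h', h1', h2', h3', h4', h5', h6', -, h8'⟩ := exists_per_succ hG (N := N) (p := p)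
        (k := k) (f := f - d h) (by convert hs.sub h4.d using 1; ring) (hi.sub h5.d) h7
        (by rw [map_sub, d_d, sub_zero]; exact (hdf _).anti h3)
      refine ⟨N', h + h', h1', h2', h3'.trans h3, h4.add h4', h5.add h5', by simp [h6, h6'], ?_⟩
      rwa [map_add, ← sub_sub]
  obtain ⟨N, h, h1, h2, -, h4, h5, h6, h7⟩ := key (n + 1) le_rfl
  exact ⟨h, h4, h5, h6, N, h1, h2, (hs.sub h4.d).per_of_le le_rfl h7⟩

end ListCochain

end

/-! ### Homology of topological modules by elements -/

namespace TopModuleCat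

open Limits

variable {R : Type*} [Ring R] [TopologicalSpace R]

/-- The left homology data given by the quotient of the kernel by the range. -/
def leftHomologyData (S : ShortComplex (TopModuleCat R)) : S.LeftHomologyData :=
  ⟨_, _, _, _, _, isLimitKer _, by simp, isColimitCoker _⟩

theorem leftHomologyData_π_surjective (S : ShortComplex (TopModuleCat R)) :
    Function.Surjective (leftHomologyData S).π :=
  cokerπ_surjective _

theorem leftHomologyData_π_eq_zero_iff (S : ShortComplex (TopModuleCat R))
    (x : (leftHomologyData S).K) :
    (leftHomologyData S).π x = 0 ↔ ∃ z, S.f z = (leftHomologyData S).i x := by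
  have h (z : S.X₁) : (leftHomologyData S).i ((leftHomologyData S).f' z) = S.f z :=
    ConcreteCategory.congr_hom (leftHomologyData S).f'_i z
  refine (Submodule.Quotient.mk_eq_zero _).trans ⟨?_, ?_⟩
  · rintro ⟨z, hz⟩
    exact ⟨z, (h z).symm.trans (congrArg (leftHomologyData S).i hz)⟩
  · rintro ⟨z, hz⟩
    exact ⟨z, Subtype.val_injective ((h z).trans hz)⟩

/-- Homology is the quotient of the kernel by the range, so bijectivity is a statement about cycles
and boundaries; the topology plays no role. -/
theorem bijective_shortComplex_homologyMap {S T : ShortComplex (TopModuleCat R)} (φ : S ⟶ T)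
    (surj : ∀ y : T.X₂, T.g y = 0 → ∃ x : S.X₂, S.g x = 0 ∧ ∃ z, T.f z = φ.τ₂ x - y)
    (inj : ∀ x : S.X₂, S.g x = 0 → (∃ z, T.f z = φ.τ₂ x) → ∃ w, S.f w = x) :
    Function.Bijective (ShortComplex.homologyMap φ) := by
  let D := leftHomologyData S
  let E := leftHomologyData T
  let m := ShortComplex.leftHomologyMap' φ D E
  have hπ (x : D.K) : m (D.π x) = E.π (ShortComplex.cyclesMap' φ D E x) :=
    ConcreteCategory.congr_hom (ShortComplex.leftHomologyπ_naturality' φ D E) x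
  have hi (x : D.K) : E.i (ShortComplex.cyclesMap' φ D E x) = φ.τ₂ (D.i x) :=
    ConcreteCategory.congr_hom (ShortComplex.cyclesMap'_i φ D E) x
  have hD (x : D.K) : S.g (D.i x) = 0 := x.2
  have hE (x : E.K) : T.g (E.i x) = 0 := x.2
  have hm : Function.Bijective m := by
    constructor
    · rw [injective_iff_map_eq_zero]
      intro a ha
      obtain ⟨x, rfl⟩ := leftHomologyData_π_surjective S a
      rw [hπ] at ha
      obtain ⟨z, hz⟩ := (leftHomologyData_π_eq_zero_iff T _).1 ha
      exact (leftHomologyData_π_eq_zero_iff S x).2 (inj _ (hD x) ⟨z, hz.trans (hi x)⟩)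
    · intro b
      obtain ⟨y, rfl⟩ := leftHomologyData_π_surjective T b
      obtain ⟨x, hx, z, hz⟩ := surj _ (hE y)
      let x' : D.K := ⟨x, hx⟩
      refine ⟨D.π x', (hπ x').trans (sub_eq_zero.1 ?_)⟩
      rw [← map_sub]
      refine (leftHomologyData_π_eq_zero_iff T _).2 ⟨z, hz.trans ?_⟩
      exact ((map_sub _ _ _).trans (congrArg (fun t : T.X₂ => t - E.i y) (hi x'))).symm
  have : ShortComplex.homologyMap φ = D.homologyIso.hom ≫ m ≫ E.homologyIso.inv :=
    (ShortComplex.leftHomologyMapData φ D E).homologyMap_eq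
  rw [this]
  have h1 := ((forget (TopModuleCat R)).mapIso D.homologyIso).toEquiv.bijective
  have h2 := ((forget (TopModuleCat R)).mapIso E.homologyIso.symm).toEquiv.bijective
  exact (h2.comp hm).comp h1

theorem bijective_homologyMap {K L : CochainComplex (TopModuleCat R) ℕ} (φ : K ⟶ L) (i p j : ℕ)
    (hi : (ComplexShape.up ℕ).prev p = i) (hj : (ComplexShape.up ℕ).next p = j)
    (surj : ∀ y : L.X p, L.d p j y = 0 → ∃ x : K.X p, K.d p j x = 0 ∧ ∃ z, L.d i p z = φ.f p x - y)
    (inj : ∀ x : K.X p, K.d p j x = 0 → (∃ z, L.d i p z = φ.f p x) → ∃ w, K.d i p w = x) :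
    Function.Bijective (HomologicalComplex.homologyMap φ p) := by
  subst hi hj
  exact bijective_shortComplex_homologyMap
    ((HomologicalComplex.shortComplexFunctor _ _ p).map φ) surj inj

end TopModuleCat

/-! ### Continuous cochains as functions on lists -/

namespace TopRep

section

variable {Γ : Type*} [Group Γ] [TopologicalSpace Γ] [IsTopologicalGroup Γ]

/-- The function on lists underlying an iterated continuous function. -/
def evalList (X : TopRep ℤ Γ) : (n : ℕ) → resolutionX X n → List Γ → X
  | 0, m, [] => m
  | 0, _, _ :: _ => 0
  | _ + 1, _, [] => 0
  | n + 1, F, x :: l => evalList X n ((show C(Γ, resolutionX X n) from F) x) l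

/-- The cochain on lists underlying an iterated continuous function. -/
def toListCochain (X : TopRep ℤ Γ) (n : ℕ) (F : resolutionX X n) : ListCochain Γ X :=
  ⟨evalList X n F⟩

variable {X : TopRep ℤ Γ}

theorem supp_toListCochain (n : ℕ) (F : resolutionX X n) : (toListCochain X n F).Supp n := by
  intro l hl
  induction n generalizing l with
  | zero => cases l <;> first | rfl | simp at hl
  | succ n ih =>
    cases l with
    | nil => rfl
    | cons x l => exact ih _ l (by simpa using hl)

theorem toListCochain_sub (n : ℕ) (F F' : resolutionX X n) :
    toListCochain X n (F - F') = toListCochain X n F - toListCochain X n F' := by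
  ext l
  induction n generalizing l with
  | zero => cases l <;> first | rfl | exact (sub_zero _).symm
  | succ n ih =>
    cases l with
    | nil => exact (sub_zero _).symm
    | cons x l => exact ih _ _ l

theorem toListCochain_zero (n : ℕ) : toListCochain X n 0 = 0 := by
  have := toListCochain_sub (X := X) n 0 0
  rwa [sub_self, sub_self] at this

theorem toListCochain_injective (n : ℕ) : Function.Injective (toListCochain X n) := by
  intro F F' h
  induction n with
  | zero => exact DFunLike.congr_fun h []
  | succ n ih =>
    refine ContinuousMap.ext (f := (F : C(Γ, resolutionX X n))) fun x => ih ?_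
    ext l
    exact DFunLike.congr_fun h (x :: l)

theorem toListCochain_d (n : ℕ) (F : resolutionX X n) :
    toListCochain X (n + 1) ((d X n).hom F) = ListCochain.d (toListCochain X n F) := by
  ext l
  induction n generalizing l with
  | zero =>
    rcases l with _ | ⟨x, _ | ⟨y, l⟩⟩
    · rfl
    · exact (sub_zero _).symm
    · rw [(supp_toListCochain _ _).d _ (by simp)]; rfl
  | succ n ih =>
    cases l with
    | nil => rfl
    | cons x l =>
      rw [ListCochain.d_cons]
      have h1 : (toListCochain X (n + 1) F).prefixed [x] =
        toListCochain X n ((show C(Γ, resolutionX X n) from F) x) := rfl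
      rw [h1, ← ih, ← ListCochain.sub_apply, ← toListCochain_sub]
      rfl

theorem toListCochain_ρ (n : ℕ) (g : Γ) (F : resolutionX X n) (l : List Γ) :
    toListCochain X n ((resolutionX X n).ρ g F) l =
      X.ρ g (toListCochain X n F (l.map (g⁻¹ * ·))) := by
  induction n generalizing l with
  | zero => cases l <;> first | rfl | exact (map_zero _).symm
  | succ n ih =>
    cases l with
    | nil => exact (map_zero _).symm
    | cons x l => exact ih _ l

/-- The iterated continuous function given by a function on lists of elements of a discrete
quotient. -/
def ofQuotient (X : TopRep ℤ Γ) {Q : Type*} [TopologicalSpace Q] [DiscreteTopology Q]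
    (π : C(Γ, Q)) : (n : ℕ) → (List Q → X) → resolutionX X n
  | 0, φ => φ []
  | n + 1, φ => (⟨fun x => ofQuotient X π n fun l => φ (π x :: l),
      (continuous_of_discreteTopology (f := fun q : Q =>
        ofQuotient X π n fun l => φ (q :: l))).comp π.continuous⟩ : C(Γ, resolutionX X n))

theorem toListCochain_ofQuotient {Q : Type*} [TopologicalSpace Q] [DiscreteTopology Q]
    (π : C(Γ, Q)) (n : ℕ) (φ : List Q → X) (l : List Γ) (hl : l.length = n) :
    toListCochain X n (ofQuotient X π n φ) l = φ (l.map π) := by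
  induction n generalizing φ l with
  | zero => obtain rfl := List.length_eq_zero_iff.1 hl; rfl
  | succ n ih =>
    cases l with
    | nil => simp at hl
    | cons x l => exact ih (fun l => φ (π x :: l)) l (by simpa using hl)

instance discreteTopology_resolutionX [CompactSpace Γ] [DiscreteTopology X] (n : ℕ) :
    DiscreteTopology (resolutionX X n) := by
  induction n with
  | zero => assumption
  | succ n ih =>
    change DiscreteTopology C(Γ, resolutionX X n)
    rw [discreteTopology_iff_isOpen_singleton]
    intro F
    have hfin : (Set.range F).Finite := (isCompact_range F.continuous).finite_of_discrete
    -- By compactness `F` has finitely many values, each on a clopen set. Mapping each of these sets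
    -- to the same value is an open condition that determines `F`.
    have : {F} = ⋂ v ∈ Set.range F, {F' : C(Γ, resolutionX X n) |
        Set.MapsTo F' (F ⁻¹' {v}) {v}} := by
      ext F'
      simp only [Set.mem_singleton_iff, Set.mem_iInter, Set.mem_range, Set.mem_ofPred_eq]
      constructor
      · rintro rfl v - x hx
        exact hx
      · intro h
        ext x
        exact h (F x) ⟨x, rfl⟩ rfl
    rw [this]
    refine hfin.isOpen_biInter fun v _ => ContinuousMap.isOpen_setOfPred_mapsTo ?_ (isOpen_discrete _)
    exact ((isClosed_discrete {v}).preimage F.continuous).isCompact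

end

end TopRep

/-- A continuous map from a compact group to a discrete space is uniformly locally constant. -/
theorem ContinuousMap.eventually_forall_mul_eq {Γ Y : Type*} [Group Γ] [TopologicalSpace Γ]
    [IsTopologicalGroup Γ] [CompactSpace Γ] [TopologicalSpace Y] [DiscreteTopology Y]
    (F : C(Γ, Y)) : ∀ᶠ u in nhds (1 : Γ), ∀ x, F (x * u) = F x := by
  have h := isCompact_univ.eventually_forall_of_forall_eventually (x₀ := (1 : Γ))
    (P := fun u x : Γ => F (x * u) = F x) fun x _ => by
    have h1 : ∀ᶠ z in nhds ((1 : Γ), x), F (z.2 * z.1) = F x := by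
      have : Continuous fun z : Γ × Γ => F (z.2 * z.1) := by fun_prop
      have h := this.tendsto ((1 : Γ), x)
      rw [nhds_discrete Y, Filter.tendsto_pure] at h
      simpa using h
    have h2 : ∀ᶠ z in nhds ((1 : Γ), x), F z.2 = F x := by
      have : Continuous fun z : Γ × Γ => F z.2 := by fun_prop
      have h := this.tendsto ((1 : Γ), x)
      rwa [nhds_discrete Y, Filter.tendsto_pure] at h
    filter_upwards [h1, h2] with z hz hz'
    rw [hz, hz']
  simpa using h

/-! ### Cochains of the profinite completion -/

namespace GoodGroup

open TopRep ListCochain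

variable (G : Type u) [Group G]

/-- The projection of the profinite completion of `G` to a finite quotient of `G`. -/
def completionToQuotient (N : FiniteIndexNormalSubgroup G) :
    Completion G →* G ⧸ N.toSubgroup where
  toFun x := x.1 N
  map_one' := rfl
  map_mul' _ _ := rfl

theorem isOpen_completionToQuotient (N : FiniteIndexNormalSubgroup G) (q : G ⧸ N.toSubgroup) :
    IsOpen (completionToQuotient G N ⁻¹' {q}) := by
  let F := ProfiniteGrp.ProfiniteCompletion.diagram (GrpCat.of G)
  have h : Continuous fun x : Completion G => (x.1 N : F.obj N) :=
    (continuous_apply (A := fun j => F.obj j) N).comp continuous_subtype_val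
  have : DiscreteTopology (F.obj N) := ⟨rfl⟩
  exact (isOpen_discrete ({q} : Set (F.obj N))).preimage h

theorem isOpen_completionToAut (M : Type u) [AddCommGroup M] [Finite M] [DistribMulAction G M]
    (a : autGrp M) : IsOpen (completionToAut G M ⁻¹' {a}) := by
  have : DiscreteTopology (autGrp M) := ⟨rfl⟩
  exact (isOpen_discrete {a}).preimage (completionToAut G M).continuous

variable [TopologicalSpace G] [DiscreteTopology G]

theorem denseRange_toCompletion : DenseRange (toCompletion G) :=
  ProfiniteGrp.ProfiniteCompletion.denseRange (GrpCat.of G)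

/-- The conditions on `g` cut out a nonempty open set, which meets the dense image of `G`. -/
theorem exists_toCompletion_eq (M : Type u) [AddCommGroup M] [Finite M] [DistribMulAction G M]
    (N : FiniteIndexNormalSubgroup G) (x : Completion G) :
    ∃ g : G, completionToQuotient G N x = completionToQuotient G N (toCompletion G g) ∧
      completionToAut G M x = completionToAut G M (toCompletion G g) := by
  obtain ⟨g, hg, hg'⟩ := (denseRange_toCompletion G).exists_mem_open
    ((isOpen_completionToQuotient G N (completionToQuotient G N x)).inter
      (isOpen_completionToAut G M (completionToAut G M x))) ⟨x, rfl, rfl⟩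
  exact ⟨g, hg.symm, hg'.symm⟩

end GoodGroup

namespace ListCochain

/-- Precomposition of a cochain with a map. -/
def comap {H G M : Type*} (r : H → G) (f : ListCochain G M) : ListCochain H M :=
  ⟨fun l => f (l.map r)⟩

theorem d_comap {H G M : Type*} [AddCommGroup M] (r : H → G) (f : ListCochain G M) :
    d (f.comap r) = (d f).comap r := by
  ext l
  induction l generalizing f with
  | nil => rfl
  | cons a l ih =>
    have h : (f.comap r).prefixed [a] = (f.prefixed [r a]).comap r := rfl
    rw [d_cons, h, ih]
    rfl

end ListCochain

namespace GoodGroup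

open TopRep ListCochain

variable (G : Type u) [Group G] [TopologicalSpace G] [DiscreteTopology G]
variable (M : Type u) [AddCommGroup M] [TopologicalSpace M] [DiscreteTopology M]
  [DistribMulAction G M]

/-- A cochain of the discrete group `G`, as a function on lists. -/
def discreteCochain (n : ℕ) (F : resolutionX (moduleRep G M) n) : ListCochain G M :=
  toListCochain (moduleRep G M) n F

variable {G M}

theorem discreteCochain_sub (n : ℕ) (F F' : resolutionX (moduleRep G M) n) :
    discreteCochain G M n (F - F') = discreteCochain G M n F - discreteCochain G M n F' :=
  toListCochain_sub n F F'

theorem discreteCochain_zero (n : ℕ) : discreteCochain G M n 0 = 0 :=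
  toListCochain_zero n

theorem supp_discreteCochain (n : ℕ) (F : resolutionX (moduleRep G M) n) :
    (discreteCochain G M n F).Supp n :=
  supp_toListCochain n F

theorem discreteCochain_injective (n : ℕ) : Function.Injective (discreteCochain G M n) :=
  toListCochain_injective n

theorem discreteCochain_d (n : ℕ) (F : resolutionX (moduleRep G M) n) :
    discreteCochain G M (n + 1) ((TopRep.d (moduleRep G M) n).hom F) =
      ListCochain.d (discreteCochain G M n F) :=
  toListCochain_d n F

theorem discreteCochain_ρ (n : ℕ) (g : G) (F : resolutionX (moduleRep G M) n) :
    discreteCochain G M n ((resolutionX (moduleRep G M) n).ρ g F) =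
      g • discreteCochain G M n F := by
  ext l
  exact toListCochain_ρ n g F l

theorem exists_discreteCochain_eq {n : ℕ} {f : ListCochain G M} (hf : f.Supp n) :
    ∃ F, discreteCochain G M n F = f := by
  refine ⟨ofQuotient (moduleRep G M) (ContinuousMap.id G) n f, ?_⟩
  ext l
  by_cases hl : l.length = n
  · refine (toListCochain_ofQuotient (X := moduleRep G M) (ContinuousMap.id G) n f l hl).trans ?_
    exact congrArg f (List.map_id l)
  · rw [supp_discreteCochain _ _ _ hl, hf _ hl]

variable [Finite M]

instance : DiscreteTopology (completionRep G M) := inferInstanceAs (DiscreteTopology M)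

variable (G M) in
/-- The restriction to `G` of a cochain of the profinite completion, as a function on lists. -/
noncomputable def pullback (n : ℕ) (F : resolutionX (completionRep G M) n) : ListCochain G M :=
  (toListCochain (completionRep G M) n F).comap (toCompletion G)

theorem discreteCochain_resolutionMap (n : ℕ) (F : resolutionX (completionRep G M) n) :
    discreteCochain G M n
      ((ContinuousCohomology.resolutionMap (toCompletion G) (resCompletionRep G M) n).hom F) =
        pullback G M n F := by
  ext l
  induction n generalizing l with
  | zero => cases l <;> rfl
  | succ n ih =>
    cases l with
    | nil => rfl
    | cons g l =>
      exact ih ((show C(Completion G, resolutionX (completionRep G M) n) from F)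
        (toCompletion G g)) l

theorem pullback_zero (n : ℕ) : pullback G M n 0 = 0 := by
  ext l
  exact DFunLike.congr_fun (toListCochain_zero (X := completionRep G M) n) _

theorem supp_pullback (n : ℕ) (F : resolutionX (completionRep G M) n) :
    (pullback G M n F).Supp n :=
  fun l hl => supp_toListCochain n F _ (by simpa using hl)

theorem pullback_d (n : ℕ) (F : resolutionX (completionRep G M) n) :
    pullback G M (n + 1) ((TopRep.d (completionRep G M) n).hom F) =
      ListCochain.d (pullback G M n F) := by
  refine Eq.trans ?_ (d_comap (toCompletion G) (toListCochain (completionRep G M) n F)).symm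
  exact congrArg _ (toListCochain_d n F)

theorem pullback_injective (n : ℕ) : Function.Injective (pullback G M n) := by
  intro F F' h
  induction n with
  | zero => exact DFunLike.congr_fun h []
  | succ n ih =>
    refine ContinuousMap.ext (f := (F : C(Completion G, resolutionX (completionRep G M) n)))
      (g := F') fun x => ?_
    refine congrFun ((denseRange_toCompletion G).equalizer (ContinuousMap.continuous _)
      (ContinuousMap.continuous _) (funext fun g => ih ?_)) x
    ext l
    exact DFunLike.congr_fun h (g :: l)

theorem pullback_ρ (n : ℕ) (g : G) (F : resolutionX (completionRep G M) n) :
    pullback G M n ((resolutionX (completionRep G M) n).ρ (toCompletion G g) F) =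
      g • pullback G M n F := by
  ext l
  refine (toListCochain_ρ (X := completionRep G M) n (toCompletion G g) F _).trans ?_
  have h1 (m : M) : (completionRep G M).ρ (toCompletion G g) m = g • m := by
    change autToEnd M (completionToAut G M (toCompletion G g)) m = _
    rw [completionToAut_toCompletion]
    rfl
  refine (h1 _).trans (congrArg (g • ·) ?_)
  refine congrArg (toListCochain (completionRep G M) n F) ?_
  simp [Function.comp_def]

/-- As a function of its first argument, a continuous cochain is invariant under an open normal
subgroup and has finitely many values. Each value is a cochain in fewer variables, so induction
provides finitely many further subgroups to intersect. -/
theorem periodic_pullback (n : ℕ) (F : resolutionX (completionRep G M) n) :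
    Periodic (pullback G M n F) := by
  induction n with
  | zero =>
    refine ⟨⊤, inferInstance, inferInstance, fun k l z g a _ _ => ?_⟩
    rw [supp_pullback _ _ _ (by simp), supp_pullback _ _ _ (by simp)]
  | succ n ih =>
    let F' : C(Completion G, resolutionX (completionRep G M) n) := F
    obtain ⟨W, hW, hWo, hW1⟩ := mem_nhds_iff.1 F'.eventually_forall_mul_eq
    obtain ⟨V, hV⟩ := ProfiniteGrp.exist_openNormalSubgroup_sub_open_nhds_of_one hWo hW1
    have hfin : (Set.range F').Finite := (isCompact_range F'.continuous).finite_of_discrete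
    have : Finite (Set.range F') := hfin
    choose N hN hN' hp using ih
    let S : Subgroup G := V.toSubgroup.comap (toCompletion G : G →* Completion G)
    have hVi : V.toSubgroup.FiniteIndex := Subgroup.finiteIndex_of_finite_quotient
    let T : Subgroup G := ⨅ v : Set.range F', N v
    have hT : T.FiniteIndex := Subgroup.finiteIndex_iInf fun v => hN' _
    have hTn : T.Normal := Subgroup.normal_iInf_normal fun v => hN _
    have hSn : S.Normal := V.isNormal'.comap _
    have hSi : S.FiniteIndex := ⟨by
      rw [Subgroup.index_comap]
      exact mt Subgroup.index_eq_zero_of_relIndex_eq_zero hVi.index_ne_zero⟩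
    refine ⟨S ⊓ T, inferInstance, inferInstance, fun k l z g a ha hz => ?_⟩
    cases l with
    | nil =>
      have h1 : F' (toCompletion G g * toCompletion G a) = F' (toCompletion G g) := hW (hV ha.1) _
      change pullback G M n (F' (toCompletion G (g * a))) z =
        pullback G M n (F' (toCompletion G g)) z
      rw [map_mul, h1]
    | cons b l =>
      exact hp (F' (toCompletion G b)) k l z g a
        (Subgroup.mem_iInf.1 ha.2 ⟨_, Set.mem_range_self _⟩) hz

/-- A periodic cochain is a function on `G ⧸ N`, hence extends along the projection of the
completion. Invariance under the completion reduces to invariance under `G`, since each `x` acts on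
this cochain like some `g`. -/
theorem exists_pullback_eq {n : ℕ} {f : ListCochain G M} (hs : f.Supp n) (hi : f.Inv)
    (hp : Periodic f) :
    ∃ F : resolutionX (completionRep G M) n, pullback G M n F = f ∧
      ∀ x, (resolutionX (completionRep G M) n).ρ x F = F := by
  obtain ⟨N, hN, hN', hp⟩ := hp
  let N₀ : FiniteIndexNormalSubgroup G := FiniteIndexNormalSubgroup.ofSubgroup N
  let π : C(Completion G, G ⧸ N) := ⟨completionToQuotient G N₀,
    continuous_discrete_rng.2 (isOpen_completionToQuotient G N₀)⟩
  let φ : List (G ⧸ N) → completionRep G M := fun ξ => f (ξ.map Quotient.out)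
  let F := ofQuotient (completionRep G M) π n φ
  have hF (l : List (Completion G)) (hl : l.length = n) :
      toListCochain (completionRep G M) n F l = φ (l.map π) :=
    toListCochain_ofQuotient π n φ l hl
  have hFf : pullback G M n F = f := by
    ext l
    by_cases hl : l.length = n
    · refine (hF _ (by simpa using hl)).trans ?_
      have := (hp n).append_eq (forall₂_out (N := N) l) hl.le []
      refine Eq.trans ?_ this.symm
      change f _ = f _
      simp only [List.nil_append, List.map_map]
      rfl
    · rw [supp_pullback _ _ _ hl, hs _ hl]
  refine ⟨F, hFf, fun x => ?_⟩
  obtain ⟨g, hg, hg'⟩ := exists_toCompletion_eq G M N₀ x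
  have h1 : (resolutionX (completionRep G M) n).ρ x F =
      (resolutionX (completionRep G M) n).ρ (toCompletion G g) F := by
    refine toListCochain_injective n ?_
    ext l
    by_cases hl : l.length = n
    · rw [toListCochain_ρ, toListCochain_ρ, hF _ (by simpa using hl), hF _ (by simpa using hl)]
      have h2 : (l.map (x⁻¹ * ·)).map π = (l.map ((toCompletion G g)⁻¹ * ·)).map π := by
        rw [List.map_map, List.map_map]
        refine List.map_congr_left fun y _ => ?_
        change completionToQuotient G N₀ (x⁻¹ * y) =
          completionToQuotient G N₀ ((toCompletion G g)⁻¹ * y)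
        rw [map_mul, map_mul, map_inv, map_inv, hg]
      rw [h2]
      change autToEnd M (completionToAut G M x) _ =
        autToEnd M (completionToAut G M (toCompletion G g)) _
      rw [hg']
    · rw [supp_toListCochain _ _ _ hl, supp_toListCochain _ _ _ hl]
  rw [h1]
  refine pullback_injective n ?_
  rw [pullback_ρ, hFf, hi]

end GoodGroup

namespace TopRep

variable {k Γ : Type*} [Ring k] [TopologicalSpace k] [Group Γ]

/-- A fixed vector, as an element of the invariants. -/
def mkInvariant (X : TopRep k Γ) (x : X) (hx : ∀ g, X.ρ g x = x) : X.invariants :=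
  ⟨x, fun g => hx g⟩

theorem ρ_invariants_apply (X : TopRep k Γ) (x : X.invariants) (g : Γ) : X.ρ g x.1 = x.1 :=
  x.2 g

end TopRep

/-! ### Bijectivity of restriction -/

namespace GoodGroup

open TopRep ListCochain

variable {G : Type u} [Group G] [TopologicalSpace G] [DiscreteTopology G]
variable {M : Type u} [AddCommGroup M] [TopologicalSpace M] [DiscreteTopology M]
  [DistribMulAction G M]

theorem inv_discreteCochain {p : ℕ} (F : (homogeneousCochains (moduleRep G M)).X p) :
    (discreteCochain G M (p + 1) F.1).Inv :=
  fun g => by rw [← discreteCochain_ρ, ρ_invariants_apply _ F g]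

theorem exists_invariants_discreteCochain_eq {p : ℕ} {f : ListCochain G M} (hf : f.Supp (p + 1))
    (hi : f.Inv) : ∃ F : (homogeneousCochains (moduleRep G M)).X p,
      discreteCochain G M (p + 1) F.1 = f := by
  obtain ⟨F, hF⟩ := exists_discreteCochain_eq hf
  refine ⟨mkInvariant _ F fun g => discreteCochain_injective (p + 1) ?_, hF⟩
  rw [discreteCochain_ρ, hF, hi]

theorem discreteCochain_homogeneousCochains_d (p : ℕ)
    (F : (homogeneousCochains (moduleRep G M)).X p) :
    discreteCochain G M (p + 2) ((homogeneousCochains (moduleRep G M)).d p (p + 1) F).1 =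
      ListCochain.d (discreteCochain G M (p + 1) F.1) :=
  (congrArg (discreteCochain G M (p + 2))
    (homogeneousCochains.d_apply (moduleRep G M) p F)).trans (discreteCochain_d _ _)

theorem d_discreteCochain_eq_zero {p : ℕ} {F : (homogeneousCochains (moduleRep G M)).X p}
    (hF : (homogeneousCochains (moduleRep G M)).d p (p + 1) F = 0) :
    ListCochain.d (discreteCochain G M (p + 1) F.1) = 0 := by
  rw [← discreteCochain_homogeneousCochains_d, hF]
  exact discreteCochain_zero _

variable [Finite M]

theorem exists_invariants_pullback_eq {p : ℕ} {f : ListCochain G M} (hs : f.Supp (p + 1))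
    (hi : f.Inv) (hp : Periodic f) : ∃ F : (homogeneousCochains (completionRep G M)).X p,
      pullback G M (p + 1) F.1 = f := by
  obtain ⟨F, hF, hF'⟩ := exists_pullback_eq hs hi hp
  exact ⟨mkInvariant _ F hF', hF⟩

theorem pullback_homogeneousCochains_d (p : ℕ)
    (F : (homogeneousCochains (completionRep G M)).X p) :
    pullback G M (p + 2) ((homogeneousCochains (completionRep G M)).d p (p + 1) F).1 =
      ListCochain.d (pullback G M (p + 1) F.1) :=
  (congrArg (pullback G M (p + 2))
    (homogeneousCochains.d_apply (completionRep G M) p F)).trans (pullback_d _ _)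

theorem discreteCochain_cochainsMap (p : ℕ) (F : (homogeneousCochains (completionRep G M)).X p) :
    discreteCochain G M (p + 1)
      ((ContinuousCohomology.cochainsMap (toCompletion G) (resCompletionRep G M)).f p F).1 =
        pullback G M (p + 1) F.1 :=
  discreteCochain_resolutionMap (p + 1) F.1

theorem d_eq_zero_of_d_pullback {p : ℕ} {F : (homogeneousCochains (completionRep G M)).X p}
    (hF : ListCochain.d (pullback G M (p + 1) F.1) = 0) :
    (homogeneousCochains (completionRep G M)).d p (p + 1) F = 0 := by
  refine Subtype.ext (pullback_injective (p + 2) ?_)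
  rw [pullback_homogeneousCochains_d, hF]
  exact (pullback_zero _).symm

/-- Both halves are instances of `exists_sub_d_periodic`: for surjectivity `d f = 0`, for
injectivity `d f` is the restriction of a continuous cocycle. -/
theorem bijective_restriction (hG : VirtuallyAcyclic M (⊤ : Subgroup G)) (p : ℕ) :
    Function.Bijective (restriction G M p) := by
  have surj {p : ℕ} (y : (homogeneousCochains (moduleRep G M)).X p)
      (hy : (homogeneousCochains (moduleRep G M)).d p (p + 1) y = 0) :
      ∃ x : (homogeneousCochains (completionRep G M)).X p,
        (homogeneousCochains (completionRep G M)).d p (p + 1) x = 0 ∧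
        ∃ h : ListCochain G M, h.Supp p ∧ h.Inv ∧ h [] = 0 ∧
          pullback G M (p + 1) x.1 = discreteCochain G M (p + 1) y.1 - ListCochain.d h := by
    have hd := d_discreteCochain_eq_zero hy
    have hs := supp_discreteCochain (p + 1) y.1
    have hi := inv_discreteCochain y
    obtain ⟨h, h1, h2, h3, h4⟩ := exists_sub_d_periodic hG hs hi (hd ▸ periodic_zero)
    obtain ⟨x, hx⟩ := exists_invariants_pullback_eq (hs.sub h1.d) (hi.sub h2.d) h4
    refine ⟨x, d_eq_zero_of_d_pullback ?_, h, h1, h2, h3, hx⟩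
    rw [hx, map_sub, hd, d_d, sub_zero]
  rcases p with _ | p
  · refine TopModuleCat.bijective_homologyMap _ 0 0 1 (by simp) (by simp) ?_ ?_
    · intro y hy
      obtain ⟨x, hx, h, h1, -, h3, h4⟩ := surj y hy
      rw [h1.eq_zero h3, map_zero, sub_zero, ← discreteCochain_cochainsMap] at h4
      have h5 := Subtype.ext (discreteCochain_injective _ h4)
      refine ⟨x, hx, 0, ?_⟩
      rw [map_zero, h5, sub_self]
    · rintro x hx ⟨z, hz⟩
      refine ⟨0, ?_⟩
      rw [map_zero]
      refine Subtype.ext (pullback_injective 1 ?_)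
      rw [(homogeneousCochains (moduleRep G M)).shape 0 0 (by simp)] at hz
      exact (pullback_zero 1).trans ((discreteCochain_zero 1).symm.trans
        (congrArg (fun t : (homogeneousCochains (moduleRep G M)).X 0 =>
          discreteCochain G M 1 t.1) hz |>.trans (discreteCochain_cochainsMap 0 x)))
  · refine TopModuleCat.bijective_homologyMap _ p (p + 1) (p + 2) (by simp) (by simp) ?_ ?_
    · intro y hy
      obtain ⟨x, hx, h, h1, h2, -, h4⟩ := surj y hy
      obtain ⟨z, hz⟩ := exists_invariants_discreteCochain_eq h1 h2
      refine ⟨x, hx, -z, ?_⟩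
      rw [map_neg, neg_eq_iff_eq_neg, neg_sub]
      refine Subtype.ext (discreteCochain_injective (p + 2) ?_)
      rw [discreteCochain_homogeneousCochains_d]
      refine Eq.trans ?_ (discreteCochain_sub _ _ _).symm
      rw [discreteCochain_cochainsMap, h4, hz, sub_sub_cancel]
    · rintro x hx ⟨z, hz⟩
      have h1 : ListCochain.d (discreteCochain G M (p + 1) z.1) = pullback G M (p + 2) x.1 := by
        rw [← discreteCochain_homogeneousCochains_d, hz, discreteCochain_cochainsMap]
      have hs := supp_discreteCochain (p + 1) z.1
      have hi := inv_discreteCochain z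
      obtain ⟨h, h2, h3, -, h4⟩ := exists_sub_d_periodic hG hs hi
        (h1 ▸ periodic_pullback (p + 2) x.1)
      obtain ⟨w, hw⟩ := exists_invariants_pullback_eq (hs.sub h2.d) (hi.sub h3.d) h4
      refine ⟨w, Subtype.ext (pullback_injective (p + 2) ?_)⟩
      rw [pullback_homogeneousCochains_d, hw, map_sub, d_d, sub_zero, h1]

end GoodGroup

theorem isGoodGroup_of_virtuallyAcyclic {G : Type u} [Group G]
    (hG : ∀ (M : Type u) [AddCommGroup M] [Finite M] [DistribMulAction G M],
      ListCochain.VirtuallyAcyclic M (⊤ : Subgroup G)) : IsGoodGroup G := by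
  intro _ _ M _ _ _ _ _ p
  exact GoodGroup.bijective_restriction (hG M) p

/-! ### Polycyclic and nilpotent groups -/

section

open Subgroup
open scoped commutatorElement

namespace Subgroup

variable {G : Type*} [Group G]

theorem exists_eq_sup_zpowers_of_isCyclic {A B : Subgroup G} (hAB : A ≤ B)
    [hn : (A.subgroupOf B).Normal] [hc : IsCyclic (B ⧸ A.subgroupOf B)] :
    ∃ t ∈ normalizer (A : Set G), B = A ⊔ zpowers t := by
  obtain ⟨x, hx⟩ := hc.exists_generator
  obtain ⟨t, rfl⟩ := QuotientGroup.mk_surjective x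
  have hnorm : B ≤ normalizer (A : Set G) := (normal_subgroupOf_iff_le_normalizer hAB).1 hn
  refine ⟨t, hnorm t.2, le_antisymm (fun b hb => ?_) (sup_le hAB (by simp))⟩
  obtain ⟨j, hj⟩ := hx (⟨b, hb⟩ : B)
  refine (mem_sup_zpowers_iff (hnorm t.2)).2 ⟨b * (t : G) ^ (-j), ?_, j, by group⟩
  have h1 : ((t ^ j : B) : B ⧸ A.subgroupOf B) = (⟨b, hb⟩ : B) := hj
  rw [QuotientGroup.eq] at h1
  have h2 : ((t : G) ^ j)⁻¹ * b ∈ A := h1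
  have h3 : (t : G) ^ j ∈ normalizer (A : Set G) := zpow_mem (hnorm t.2) j
  have h4 := (mem_normalizer_iff.1 h3 _).1 h2
  simpa [mul_assoc] using h4

theorem mem_normalizer_map_subtype {P : Subgroup G} {A : Subgroup P} {t : P}
    (ht : t ∈ normalizer (A : Set P)) : (t : G) ∈ normalizer (A.map P.subtype : Set G) := by
  rw [mem_normalizer_iff]
  intro x
  constructor
  · rintro ⟨a, ha, rfl⟩
    exact ⟨t * a * t⁻¹, (mem_normalizer_iff.1 ht a).1 ha, rfl⟩
  · rintro ⟨a, ha, h⟩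
    refine ⟨t⁻¹ * a * t, (mem_normalizer_iff''.1 ht a).1 ha, ?_⟩
    change (t : G)⁻¹ * a * t = x
    rw [show (a : G) = t * x * (t : G)⁻¹ from h]
    group

/-- Successive quotients of the lower central series are central, so `⁅T, ⊤⁆` already lies in `T`.
-/
theorem normal_of_lowerCentralSeries_le {i : ℕ} {T : Subgroup G}
    (h1 : (⊤ : Subgroup G).lowerCentralSeries (i + 1) ≤ T)
    (h2 : T ≤ (⊤ : Subgroup G).lowerCentralSeries i) : T.Normal := by
  rw [← commutator_top_right_le_iff]
  refine (commutator_mono h2 le_rfl).trans (le_trans ?_ h1)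
  rw [lowerCentralSeries_succ]

/-- The next term is generated, modulo the one after it, by the commutators `⁅a, b⁆` with `a` among
the generators of the current term and `b` among those of `G`. -/
theorem exists_finite_lowerCentralSeries_eq [Group.FG G] (i : ℕ) :
    ∃ S : Set G, S.Finite ∧ (⊤ : Subgroup G).lowerCentralSeries i =
      (⊤ : Subgroup G).lowerCentralSeries (i + 1) ⊔ closure S := by
  obtain ⟨S₀, hS₀, hS₀'⟩ := (fg_iff (⊤ : Subgroup G)).1 Group.FG.out
  induction i with
  | zero => exact ⟨S₀, hS₀', by rw [hS₀]; simp⟩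
  | succ i ih =>
    obtain ⟨S, hS, hi⟩ := ih
    set γ := (⊤ : Subgroup G).lowerCentralSeries with hγ
    have hγs (j : ℕ) : γ (j + 1) = ⁅γ j, ⊤⁆ := lowerCentralSeries_succ _ _
    have hSi : S ⊆ γ i := by rw [hi]; exact subset_closure.trans (le_sup_right (a := γ (i + 1)))
    let R : Set G := (fun p : G × G => ⁅p.1, p.2⁆) '' (S ×ˢ S₀)
    have hR : closure R ≤ γ (i + 1) := by
      rw [closure_le]
      rintro _ ⟨⟨a, b⟩, ⟨ha, -⟩, rfl⟩
      rw [hγs]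
      exact commutator_mem_commutator (hSi ha) (mem_top b)
    refine ⟨R, (hS.prod hS₀').image _, le_antisymm ?_
      (sup_le (lowerCentralSeries_antitone _ (Nat.le_succ _)) hR)⟩
    set T := γ (i + 1 + 1) ⊔ closure R
    have hT : T.Normal := normal_of_lowerCentralSeries_le (i := i + 1) le_sup_left
      (sup_le (lowerCentralSeries_antitone _ (Nat.le_succ _)) hR)
    have hcomm (a b : G) : ⁅a, b⁆ ∈ T ↔ Commute (a : G ⧸ T) (b : G ⧸ T) := by
      rw [← QuotientGroup.eq_one_iff, ← commutatorElement_eq_one_iff_commute]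
      rfl
    -- Modulo `T`, elements of `γ (i + 1)` are central because `γ (i + 2) ≤ T`, and elements of `S`
    -- because they commute with the generators of `G`.
    have hC : γ i ≤ (center (G ⧸ T)).comap (QuotientGroup.mk' T) := by
      rw [hi]
      refine sup_le ?_ ((closure_le _).2 ?_)
      · intro y hy
        rw [mem_comap, mem_center_iff]
        intro q
        obtain ⟨g, rfl⟩ := QuotientGroup.mk_surjective q
        refine ((hcomm y g).1 (le_sup_left (a := γ (i + 1 + 1)) ?_)).symm
        rw [hγs]
        exact commutator_mem_commutator hy (mem_top g)
      · intro a ha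
        have h1 : (⊤ : Subgroup G) ≤
            (centralizer {(a : G ⧸ T)}).comap (QuotientGroup.mk' T) := by
          rw [← hS₀, closure_le]
          intro b hb
          rw [SetLike.mem_coe, mem_comap, mem_centralizer_singleton_iff]
          exact ((hcomm a b).1 (le_sup_right (a := γ (i + 1 + 1))
            (subset_closure ⟨(a, b), ⟨ha, hb⟩, rfl⟩))).symm
        rw [SetLike.mem_coe, mem_comap, mem_center_iff]
        intro q
        obtain ⟨g, rfl⟩ := QuotientGroup.mk_surjective q
        exact mem_centralizer_singleton_iff.1 (h1 (mem_top g))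
    rw [hγs i, commutator_le]
    intro a ha g _
    exact (hcomm a g).2 (mem_center_iff.1 (hC ha) g).symm

end Subgroup

namespace ListCochain

variable {G M : Type*} [Group G] [AddCommGroup M] [DistribMulAction G M]

variable (M) in
/-- A finitely generated subgroup whose cohomology virtually vanishes. -/
def FGVirtuallyAcyclic (H : Subgroup G) : Prop := H.FG ∧ VirtuallyAcyclic M H

theorem fgVirtuallyAcyclic_bot : FGVirtuallyAcyclic M (⊥ : Subgroup G) :=
  ⟨Subgroup.FG.bot, virtuallyAcyclic_bot⟩

theorem FGVirtuallyAcyclic.sup_zpowers [Finite M] {N : Subgroup G} (hN : FGVirtuallyAcyclic M N)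
    {t : G} (ht : t ∈ normalizer (N : Set G)) : FGVirtuallyAcyclic M (N ⊔ zpowers t) :=
  ⟨hN.1.sup (zpowers_eq_closure t ▸ (Subgroup.fg_iff _).2 ⟨_, rfl, Set.finite_singleton t⟩),
    hN.2.sup_zpowers hN.1 ht⟩

theorem virtuallyAcyclic_of_isAlmostPolycyclic [Finite M] (hG : IsAlmostPolycyclic G) :
    VirtuallyAcyclic M (⊤ : Subgroup G) := by
  obtain ⟨P, hP, n, H, h0, hn, hH⟩ := hG
  have key (i : ℕ) (hi : i ≤ n) : FGVirtuallyAcyclic M ((H i).map P.subtype) := by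
    induction i with
    | zero => rw [h0, Subgroup.map_bot]; exact fgVirtuallyAcyclic_bot
    | succ i ih =>
      obtain ⟨hle, hnorm, hcyc⟩ := hH i hi
      obtain ⟨t, ht, heq⟩ := exists_eq_sup_zpowers_of_isCyclic hle
      rw [heq, Subgroup.map_sup, MonoidHom.map_zpowers]
      exact (ih (by omega)).sup_zpowers (mem_normalizer_map_subtype ht)
  have h1 := (key n le_rfl).2
  rw [hn, ← MonoidHom.range_eq_map, range_subtype] at h1
  exact h1.of_relIndex_ne_zero le_top (by rw [relIndex_top_right]; exact hP.index_ne_zero)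

theorem virtuallyAcyclic_of_isNilpotent [Finite M] [Group.FG G] [hG : Group.IsNilpotent G] :
    VirtuallyAcyclic M (⊤ : Subgroup G) := by
  set γ := (⊤ : Subgroup G).lowerCentralSeries with hγ
  obtain ⟨c, hc⟩ := Subgroup.nilpotent_iff_lowerCentralSeries.1 hG
  have step (i : ℕ) (hi : FGVirtuallyAcyclic M (γ (i + 1))) : FGVirtuallyAcyclic M (γ i) := by
    obtain ⟨S, hS, heq⟩ := exists_finite_lowerCentralSeries_eq (G := G) i
    -- Generators are adjoined one at a time. Every intermediate subgroup lies between consecutive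
    -- terms of the series, hence is normal, so each step is a `sup_zpowers`.
    suffices H : ∀ s ⊆ S, FGVirtuallyAcyclic M (γ (i + 1) ⊔ closure s) by
      rw [hγ, heq]; exact H S subset_rfl
    intro s hs
    induction s, hS.subset hs using Set.Finite.induction_on with
    | empty => simpa using hi
    | @insert a s _ _ ih =>
      have hs' : s ⊆ S := (Set.subset_insert a s).trans hs
      have hn : (γ (i + 1) ⊔ closure s).Normal := normal_of_lowerCentralSeries_le (i := i)
        le_sup_left (by rw [heq]; exact sup_le_sup_left (closure_mono hs') _)
      have h1 : closure (insert a s) = closure s ⊔ zpowers a := by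
        rw [← Set.union_singleton, Subgroup.closure_union, zpowers_eq_closure]
      rw [h1, ← sup_assoc]
      refine (ih hs').sup_zpowers ?_
      rw [normalizer_eq_top]
      exact mem_top a
  have key (j : ℕ) : ∀ i, i + j = c → FGVirtuallyAcyclic M (γ i) := by
    induction j with
    | zero =>
      rintro i rfl
      rw [hγ, show (⊤ : Subgroup G).lowerCentralSeries i = ⊥ from hc]
      exact fgVirtuallyAcyclic_bot
    | succ j ih => exact fun i hi => step i (ih (i + 1) (by omega))
  exact (key c 0 (by omega)).2

end ListCochain

end

theorem mainTheorem10 :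
    (∀ (G : Type u) [Group G], IsAlmostPolycyclic G → IsGoodGroup G) ∧
    (∀ (G : Type u) [Group G], Group.FG G → Group.IsNilpotent G → IsGoodGroup G) :=
  ⟨fun _ _ hG => isGoodGroup_of_virtuallyAcyclic fun _ _ _ _ =>
      ListCochain.virtuallyAcyclic_of_isAlmostPolycyclic hG,
    fun _ _ _ _ => isGoodGroup_of_virtuallyAcyclic fun _ _ _ _ =>
      ListCochain.virtuallyAcyclic_of_isNilpotent⟩
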